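/- Write $S^2_k$ for the simply connected surface of constant Gauss curvature $k$, $x_0\in S^2_k$ for a base point, and $D^2$ for a closed disc centred at $0\in\mathbb R^2$, of some radius $\rho>0$. **Theorem 3.1.** For every $k\in\mathbb R$ there is a constant $C$ such that for all numbers $\varepsilon,\delta,r_0>0$ (in particular for all small ones) there exist $\rho>0$ and a smooth Riemannian metric on the solid cylinder $D^2\times\mathbb R$ which, in cylindrical coordinates $(r,\theta,t)$ with $0<r\le\rho$, has the doubly warped form $$\boldsymbol g=e^{-2u(r)}\big(dr^2+f(r)^2\,d\theta^2\big)+e^{2u(r)}\,dt^2,$$ with $u,f$ smooth on $[0,\rho]$ and $f>0$ on $(0,\rho]$, and there is $r_1\in(0,r_0]$, with $2r_1<\pi/\sqrt k$ if $k>0$, such that: 1. the scalar curvature of $\boldsymbol g$ is at least $2(k-\varepsilon)$; 2. a neighborhood of $\partial D^2\times\mathbb R$ is isometric to $\{\tfrac32r_1\le d(\cdot,x_0)\le 2r_1\}\times\mathbb R\subset S^2_k\times\mathbb R$, by an isometry taking $\partial D^2\times\mathbb R$ onto $\{d(\cdot,x_0)=2r_1\}\times\mathbb R$; 3. $u=0$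 in a neighborhood of $\partial D^2\times\mathbb R$; 4. $e^u\le\delta$ in a neighborhood of $r=0$; 5. for every $s\in(0,\rho]$ the cylinder $\{r=s\}\times\mathbb R$ is strictly mean convex, that is, its mean curvature with respect to the unit normal pointing in the direction of increasing $r$ (the divergence of that normal) is positive; 6. $d_{\boldsymbol g}\big(\{0\}\times\mathbb R,\ \partial D^2\times\mathbb R\big)<r_0$; 7. $\operatorname{vol}(D^2\times[0,1],\boldsymbol g)<100\,V_0$, where $V_0$ is the volume of $\{d(\cdot,x_0)\le 2r_1\}\times[0,1]\subset S^2_k\times[0,1]$; moreover $\operatorname{vol}(D^2\times[0,1],\boldsymbol g)\le C\,r_1^2$. -/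

import Mathlib

open Set Filter Topology MeasureTheory
open scoped ContDiff ENNReal Matrix

namespace Drawstring

noncomputable section

/-! Riemannian geometry of a subset `S` of `ℝⁿ` (an open set, or a domain with boundary), where
a metric is given by its matrix `g p` in the standard coordinates. Derivatives are taken within
`S`, so that they make sense up to the boundary of `S`. -/

/-- The partial derivative `∂ᵢ F` at `p`, taken within `S`. -/
def pd {n : ℕ} (S : Set (Fin n → ℝ)) (F : (Fin n → ℝ) → ℝ) (i : Fin n) (p : Fin n → ℝ) : ℝ :=
  fderivWithin ℝ F S p (Pi.single i 1)

/-- `g` is a smooth Riemannian metric on `S`, up to the boundary. -/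
structure IsRiemannianMetricOn {n : ℕ} (S : Set (Fin n → ℝ))
    (g : (Fin n → ℝ) → Matrix (Fin n) (Fin n) ℝ) : Prop where
  smooth : ∀ i j, ContDiffOn ℝ ∞ (fun p => g p i j) S
  posDef : ∀ p ∈ S, (g p).PosDef

/-- The Christoffel symbol `Γˡᵢⱼ` of the Levi-Civita connection of `g`. -/
def christoffel {n : ℕ} (S : Set (Fin n → ℝ)) (g : (Fin n → ℝ) → Matrix (Fin n) (Fin n) ℝ)
    (l i j : Fin n) (p : Fin n → ℝ) : ℝ :=
  1 / 2 * ∑ m, (g p)⁻¹ l m *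
    (pd S (fun q => g q j m) i p + pd S (fun q => g q i m) j p - pd S (fun q => g q i j) m p)

/-- The curvature tensor `Rˡₖᵢⱼ`, that is, `R(∂ᵢ, ∂ⱼ)∂ₖ = ∑ₗ Rˡₖᵢⱼ ∂ₗ` with
`R(X, Y)Z = ∇_X ∇_Y Z - ∇_Y ∇_X Z - ∇_[X,Y] Z`. -/
def riemannCurvature {n : ℕ} (S : Set (Fin n → ℝ))
    (g : (Fin n → ℝ) → Matrix (Fin n) (Fin n) ℝ) (l k i j : Fin n) (p : Fin n → ℝ) : ℝ :=
  pd S (christoffel S g l j k) i p - pd S (christoffel S g l i k) j p +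
    ∑ m, (christoffel S g l i m p * christoffel S g m j k p -
      christoffel S g l j m p * christoffel S g m i k p)

/-- The Ricci tensor `Ricⱼₖ = ∑ᵢ Rⁱₖᵢⱼ`. -/
def ricciCurvature {n : ℕ} (S : Set (Fin n → ℝ))
    (g : (Fin n → ℝ) → Matrix (Fin n) (Fin n) ℝ) (j k : Fin n) (p : Fin n → ℝ) : ℝ :=
  ∑ i, riemannCurvature S g i k i j p

/-- The scalar curvature. -/
def scalarCurvature {n : ℕ} (S : Set (Fin n → ℝ))
    (g : (Fin n → ℝ) → Matrix (Fin n) (Fin n) ℝ) (p : Fin n → ℝ) : ℝ :=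
  ∑ j, ∑ k, (g p)⁻¹ j k * ricciCurvature S g j k p

/-- The gradient of `F` with respect to `g`. -/
def metricGradient {n : ℕ} (S : Set (Fin n → ℝ)) (g : (Fin n → ℝ) → Matrix (Fin n) (Fin n) ℝ)
    (F : (Fin n → ℝ) → ℝ) (p : Fin n → ℝ) : Fin n → ℝ :=
  (g p)⁻¹ *ᵥ (fun i => pd S F i p)

/-- The unit normal `∇F / |∇F|` of the level sets of `F`, pointing towards larger values. -/
def unitNormal {n : ℕ} (S : Set (Fin n → ℝ)) (g : (Fin n → ℝ) → Matrix (Fin n) (Fin n) ℝ)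
    (F : (Fin n → ℝ) → ℝ) (p : Fin n → ℝ) : Fin n → ℝ :=
  (√(metricGradient S g F p ⬝ᵥ (g p *ᵥ metricGradient S g F p)))⁻¹ • metricGradient S g F p

/-- The mean curvature at `p` of the level set of `F` through `p`, with respect to the unit normal
`ν = ∇F / |∇F|`: the trace of `X ↦ ∇_X ν`. The direction of `ν` contributes nothing to the trace,
because `⟨∇_ν ν, ν⟩ = 0`, so this is the trace of the second fundamental form. -/
def meanCurvature {n : ℕ} (S : Set (Fin n → ℝ)) (g : (Fin n → ℝ) → Matrix (Fin n) (Fin n) ℝ)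
    (F : (Fin n → ℝ) → ℝ) (p : Fin n → ℝ) : ℝ :=
  ∑ i, (pd S (fun q => unitNormal S g F q i) i p +
    ∑ j, christoffel S g i i j p * unitNormal S g F p j)

/-- The length of the path `c : [0, 1] → ℝⁿ` with respect to `g`. -/
def pathLength {n : ℕ} (g : (Fin n → ℝ) → Matrix (Fin n) (Fin n) ℝ) (c : ℝ → Fin n → ℝ) : ℝ≥0∞ :=
  ∫⁻ s in Icc (0 : ℝ) 1, ENNReal.ofReal
    √(derivWithin c (Icc 0 1) s ⬝ᵥ (g (c s) *ᵥ derivWithin c (Icc 0 1) s))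

/-- The Riemannian distance of `(S, g)` between two sets `A` and `B`: the infimum of the lengths
of the `C¹` paths in `S` from a point of `A` to a point of `B`. -/
def setDist {n : ℕ} (S : Set (Fin n → ℝ)) (g : (Fin n → ℝ) → Matrix (Fin n) (Fin n) ℝ)
    (A B : Set (Fin n → ℝ)) : ℝ≥0∞ :=
  ⨅ c ∈ {c : ℝ → Fin n → ℝ | ContDiffOn ℝ 1 c (Icc 0 1) ∧ MapsTo c (Icc 0 1) S ∧
    c 0 ∈ A ∧ c 1 ∈ B}, pathLength g c

/-- The Riemannian volume of `A` with respect to `g`. -/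
def riemannianVolume {n : ℕ} (g : (Fin n → ℝ) → Matrix (Fin n) (Fin n) ℝ)
    (A : Set (Fin n → ℝ)) : ℝ≥0∞ :=
  ∫⁻ p in A, ENNReal.ofReal √(g p).det

/-- The Jacobian matrix of `Φ` at `p`, within `N`. -/
def jacobian {m n : ℕ} (N : Set (Fin n → ℝ)) (Φ : (Fin n → ℝ) → Fin m → ℝ) (p : Fin n → ℝ) :
    Matrix (Fin m) (Fin n) ℝ :=
  Matrix.of fun a i => pd N (fun q => Φ q a) i p

/-- The matrix at `p` of the pullback metric `Φ^* h`. -/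
def pullback {m n : ℕ} (N : Set (Fin n → ℝ)) (Φ : (Fin n → ℝ) → Fin m → ℝ)
    (h : (Fin m → ℝ) → Matrix (Fin m) (Fin m) ℝ) (p : Fin n → ℝ) : Matrix (Fin n) (Fin n) ℝ :=
  (jacobian N Φ p)ᵀ * h (Φ p) * jacobian N Φ p

/-- `Φ` is a Riemannian isometry of `(N, g)` onto `(A, h)`: a diffeomorphism of `N` onto `A`
with `Φ^* h = g`. -/
structure IsRiemannianIsometry {n : ℕ} (N : Set (Fin n → ℝ))
    (g : (Fin n → ℝ) → Matrix (Fin n) (Fin n) ℝ) (A : Set (Fin n → ℝ))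
    (h : (Fin n → ℝ) → Matrix (Fin n) (Fin n) ℝ) (Φ : (Fin n → ℝ) → Fin n → ℝ) : Prop where
  smooth : ContDiffOn ℝ ∞ Φ N
  bijOn : BijOn Φ N A
  smooth_inverse : ∃ Ψ : (Fin n → ℝ) → Fin n → ℝ, ContDiffOn ℝ ∞ Ψ A ∧ InvOn Ψ Φ N A
  isometry : ∀ p ∈ N, pullback N Φ h p = g p

/-! The simply connected space form `S²ₖ` of constant Gauss curvature `k`, in the conformal
(stereographic / Poincaré disc) coordinate centred at `x₀`. For `k ≤ 0` the coordinate covers all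
of `S²ₖ`; for `k > 0` it covers everything but the point antipodal to `x₀`, which is at
distance `π / √k` from `x₀`. -/

/-- The range of the conformal coordinate. -/
def spaceFormDomain (k : ℝ) : Set (Fin 2 → ℝ) :=
  {z | 0 < 1 + k / 4 * (z 0 ^ 2 + z 1 ^ 2)}

/-- The conformal factor: the metric of `S²ₖ` is this function times `dx² + dy²`. -/
def spaceFormFactor (k : ℝ) (z : Fin 2 → ℝ) : ℝ :=
  ((1 + k / 4 * (z 0 ^ 2 + z 1 ^ 2)) ^ 2)⁻¹

/-- The metric of `S²ₖ`. -/
def spaceFormMetric (k : ℝ) (z : Fin 2 → ℝ) : Matrix (Fin 2) (Fin 2) ℝ :=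
  Matrix.diagonal ![spaceFormFactor k z, spaceFormFactor k z]

/-- The distance `d(z, x₀)` in `S²ₖ`. -/
def spaceFormDist (k : ℝ) (z : Fin 2 → ℝ) : ℝ≥0∞ :=
  setDist (spaceFormDomain k) (spaceFormMetric k) {z} {0}

/-- The projection `ℝ² × ℝ → ℝ²`. -/
def base (p : Fin 3 → ℝ) : Fin 2 → ℝ := ![p 0, p 1]

/-- The product metric of `S²ₖ × ℝ`. -/
def productMetric (k : ℝ) (p : Fin 3 → ℝ) : Matrix (Fin 3) (Fin 3) ℝ :=
  Matrix.diagonal ![spaceFormFactor k (base p), spaceFormFactor k (base p), 1]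

/-- `{a ≤ d(-, x₀) ≤ b} × I` in `S²ₖ × ℝ`, for a set `I` of reals. -/
def annularRegion (k a b : ℝ) (I : Set ℝ) : Set (Fin 3 → ℝ) :=
  {p | base p ∈ spaceFormDomain k ∧ ENNReal.ofReal a ≤ spaceFormDist k (base p) ∧
    spaceFormDist k (base p) ≤ ENNReal.ofReal b ∧ p 2 ∈ I}

/-! The solid cylinder `D² × ℝ`, where `D²` is the closed disc of radius `ρ`. -/

/-- The cylindrical coordinate `r`, the Euclidean distance to the axis. -/
def radius (p : Fin 3 → ℝ) : ℝ := √(p 0 ^ 2 + p 1 ^ 2)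

/-- `D² × ℝ`. -/
def solidCylinder (ρ : ℝ) : Set (Fin 3 → ℝ) := {p | radius p ≤ ρ}

/-- `∂D² × ℝ`. -/
def lateralBoundary (ρ : ℝ) : Set (Fin 3 → ℝ) := {p | radius p = ρ}

/-- `{0} × ℝ`. -/
def axis : Set (Fin 3 → ℝ) := {p | radius p = 0}

/-- Cylindrical coordinates: `(r, θ, t) ↦ (r cos θ, r sin θ, t)`. -/
def cylindrical (q : Fin 3 → ℝ) : Fin 3 → ℝ :=
  ![q 0 * Real.cos (q 1), q 0 * Real.sin (q 1), q 2]

/-- In cylindrical coordinates, `g = e^{-2u(r)} (dr² + f(r)² dθ²) + e^{2u(r)} dt²` on the part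
`0 < r ≤ ρ` of the solid cylinder. -/
def HasDoublyWarpedForm (ρ : ℝ) (u f : ℝ → ℝ)
    (g : (Fin 3 → ℝ) → Matrix (Fin 3) (Fin 3) ℝ) : Prop :=
  ∀ q : Fin 3 → ℝ, q 0 ∈ Ioc 0 ρ →
    pullback univ cylindrical g q = Matrix.diagonal
      ![Real.exp (-2 * u (q 0)), Real.exp (-2 * u (q 0)) * f (q 0) ^ 2, Real.exp (2 * u (q 0))]

end

end Drawstring

open Drawstring

/-! For $g=e^{-2u}(dr^2+f^2d\theta^2)+e^{2u}dt^2$ the scalar curvature is $2e^{2u}(-f''/f-u'^2)$,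
the mean curvature of the cylinders is $e^uf'/f$ and the volume density is $e^{-u}f$. Making $e^u$
tiny on the axis therefore costs only the term $-u'^2$, and this cost can be made small because a
line has zero capacity in $\mathbb R^3$, as a point has in the plane. With $q=r^2$, $u=U(q)$ and
$s=e^{-2X}$, the potential `logCutoff` drops from $0$ to $-\Lambda$ on a logarithmic scale of length
$X$, so that $qU'^2\le a^2/(q+s)$ with $a=\Lambda C/X$.

Write $f=r\varphi(q)$, so that $-f''/f=-(6\varphi'+4q\varphi'')/\varphi$. Subtracting
$\alpha\log(1+q/s)$ from $\varphi$ adds at least $2\alpha/(q+s)$ to the numerator. Taking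
$\alpha=4a^2+|k|(e^{2\Lambda}+1)e^{-X}$ pays for $u'^2$ and for the small factor $e^{2u}$. The total
change of $\varphi$ is about $\alpha X$, which tends to $0$ as $X\to\infty$. Hence `warpProfile` can
return to the model $\operatorname{sn}(r)/r$ across the fixed annulus $r_1^2\le q\le2r_1^2$ with
arbitrarily small error in curvature.

The estimates are `scalar_bound_of_lt` (inside the annulus) and `scalar_bound_of_ge` (the annulus
and beyond), joined in `warpProfile_bounds`; `exists_log_scale` chooses $X$, and
`exists_drawstring_profile` collects the result. The geometry is in `scalarCurvature_warpedMetric`,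
`meanCurvature_warpedMetric` and `IsModelPair.isRiemannianIsometry`. Since $e^{-u}$ is large only on
a core of radius $e^{-X/2}$, distance and volume stay comparable to $r_1$ and $r_1^2$. -/

namespace Drawstring

/-! ### Calculus of partial derivatives within a set. -/

/-- `F` is differentiable at `p` within `S`, and `d` is a vector of partial derivatives. -/
def HasPartials {n : ℕ} (S : Set (Fin n → ℝ)) (F : (Fin n → ℝ) → ℝ) (d : Fin n → ℝ)
    (p : Fin n → ℝ) : Prop :=
  HasFDerivWithinAt F (∑ i, d i • (ContinuousLinearMap.proj i : (Fin n → ℝ) →L[ℝ] ℝ)) S p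

namespace HasPartials

variable {n : ℕ} {S : Set (Fin n → ℝ)} {F G : (Fin n → ℝ) → ℝ} {d e : Fin n → ℝ}
  {p : Fin n → ℝ}

/-- Unique differentiability turns any expansion within `S`, even at a boundary point, into the
value of `pd`; the derivatives in the curvature and isometry computations are found this way. -/
theorem pd_eq (h : HasPartials S F d p) (hS : UniqueDiffWithinAt ℝ S p) (i : Fin n) :
    pd S F i p = d i := by
  unfold pd
  rw [HasFDerivWithinAt.fderivWithin h hS]
  simp [Pi.single_apply]

theorem const (c : ℝ) : HasPartials S (fun _ => c) 0 p := by
  simpa [HasPartials] using hasFDerivWithinAt_const c p S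

theorem coord (j : Fin n) : HasPartials S (fun q => q j) (Pi.single j 1) p := by
  have : (∑ i, (Pi.single j 1 : Fin n → ℝ) i •
      (ContinuousLinearMap.proj i : (Fin n → ℝ) →L[ℝ] ℝ)) = ContinuousLinearMap.proj j := by
    rw [Finset.sum_eq_single j] <;> simp +contextual
  unfold HasPartials
  rw [this]
  exact (ContinuousLinearMap.proj j : (Fin n → ℝ) →L[ℝ] ℝ).hasFDerivWithinAt

theorem add (hF : HasPartials S F d p) (hG : HasPartials S G e p) :
    HasPartials S (fun q => F q + G q) (d + e) p := by
  refine (HasFDerivWithinAt.fun_add hF hG).congr_fderiv ?_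
  ext v
  simp [add_mul, Finset.sum_add_distrib]

theorem mul (hF : HasPartials S F d p) (hG : HasPartials S G e p) :
    HasPartials S (fun q => F q * G q) (F p • e + G p • d) p := by
  refine (HasFDerivWithinAt.fun_mul hF hG).congr_fderiv ?_
  ext v
  simp [add_mul, Finset.sum_add_distrib, Finset.mul_sum, mul_assoc]

theorem comp {c : ℝ → ℝ} {c' : ℝ} (hc : HasDerivAt c c' (F p)) (hF : HasPartials S F d p) :
    HasPartials S (fun q => c (F q)) (c' • d) p := by
  refine (hc.comp_hasFDerivWithinAt p hF).congr_fderiv ?_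
  ext v
  simp [Finset.mul_sum, mul_assoc]

theorem congr (hF : HasPartials S F d p) (h : G =ᶠ[𝓝[S] p] F) (hp : p ∈ S) :
    HasPartials S G d p :=
  HasFDerivWithinAt.congr_of_eventuallyEq hF h (h.self_of_nhdsWithin hp)

end HasPartials

/-! ### Metrics on $\mathbb R^3$ invariant under rotation about the axis and translation along it.
-/

/-- The square of the distance to the axis. -/
def radiusSq (p : Fin 3 → ℝ) : ℝ := p 0 ^ 2 + p 1 ^ 2

theorem radiusSq_nonneg (p : Fin 3 → ℝ) : 0 ≤ radiusSq p := by unfold radiusSq; positivity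

theorem radius_eq (p : Fin 3 → ℝ) : radius p = √(radiusSq p) := rfl

theorem radius_sq (p : Fin 3 → ℝ) : radius p ^ 2 = radiusSq p := Real.sq_sqrt (radiusSq_nonneg p)

theorem radius_nonneg (p : Fin 3 → ℝ) : 0 ≤ radius p := Real.sqrt_nonneg _

/-- The Kronecker symbol of the horizontal directions. -/
def horiz (i j : Fin 3) : ℝ := if i = j ∧ i ≠ 2 then 1 else 0

/-- The horizontal part of a point. -/
def hc (i : Fin 3) (p : Fin 3 → ℝ) : ℝ := if i = 2 then 0 else p i

theorem hasPartials_hc (S : Set (Fin 3 → ℝ)) (i : Fin 3) (p : Fin 3 → ℝ) :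
    HasPartials S (hc i) (horiz i) p := by
  by_cases h : i = 2
  · have := HasPartials.const (S := S) (p := p) 0
    convert this using 1 <;> ext <;> simp [hc, horiz, h]
  · have := HasPartials.coord (S := S) (p := p) i
    convert this using 1 <;> ext j <;> simp [hc, horiz, h, Pi.single_apply, eq_comm]

theorem hasPartials_radiusSq (S : Set (Fin 3 → ℝ)) (p : Fin 3 → ℝ) :
    HasPartials S radiusSq (fun m => 2 * hc m p) p := by
  have := ((hasPartials_hc S 0 p).mul (hasPartials_hc S 0 p)).add
    ((hasPartials_hc S 1 p).mul (hasPartials_hc S 1 p))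
  have h1 : radiusSq = fun q => hc 0 q * hc 0 q + hc 1 q * hc 1 q := by
    ext q; simp [radiusSq, hc]; ring
  have h2 : (fun m => 2 * hc m p) = hc 0 p • horiz 0 + hc 0 p • horiz 0 +
      (hc 1 p • horiz 1 + hc 1 p • horiz 1) := by
    ext m; fin_cases m <;> simp [hc, horiz] <;> ring
  rw [h1, h2]
  exact this

theorem HasDerivAt.hasPartials_radiusSq {c : ℝ → ℝ} {c' : ℝ} {p : Fin 3 → ℝ}
    (hc' : HasDerivAt c c' (radiusSq p)) (S : Set (Fin 3 → ℝ)) :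
    HasPartials S (fun q => c (radiusSq q)) (fun m => c' * (2 * hc m p)) p :=
  HasPartials.comp hc' (Drawstring.hasPartials_radiusSq S p)

/-- The matrix `a δ + b x ⊗ x` in the horizontal directions, `c` in the vertical direction, with
coefficients depending on the squared radius. -/
def radialMetric (a b c : ℝ → ℝ) (p : Fin 3 → ℝ) : Matrix (Fin 3) (Fin 3) ℝ :=
  !![a (radiusSq p) + b (radiusSq p) * p 0 ^ 2, b (radiusSq p) * (p 0 * p 1), 0;
     b (radiusSq p) * (p 0 * p 1), a (radiusSq p) + b (radiusSq p) * p 1 ^ 2, 0;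
     0, 0, c (radiusSq p)]

theorem radialMetric_apply (a b c : ℝ → ℝ) (p : Fin 3 → ℝ) (i j : Fin 3) :
    radialMetric a b c p i j = a (radiusSq p) * horiz i j + b (radiusSq p) * (hc i p * hc j p) +
      c (radiusSq p) * (if i = 2 ∧ j = 2 then 1 else 0) := by
  fin_cases i <;> fin_cases j <;>
    simp [radialMetric, horiz, hc, -mul_eq_mul_left_iff] <;> ring

theorem hasPartials_radialMetric {a b c : ℝ → ℝ} {a' b' c' : ℝ} {p : Fin 3 → ℝ}
    (ha : HasDerivAt a a' (radiusSq p)) (hb : HasDerivAt b b' (radiusSq p))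
    (hc' : HasDerivAt c c' (radiusSq p)) (S : Set (Fin 3 → ℝ)) (i j : Fin 3) :
    HasPartials S (fun p => radialMetric a b c p i j)
      (fun m => 2 * hc m p * (a' * horiz i j + b' * (hc i p * hc j p) +
        c' * (if i = 2 ∧ j = 2 then 1 else 0)) +
        b (radiusSq p) * (horiz i m * hc j p + horiz j m * hc i p)) p := by
  have h := (((ha.hasPartials_radiusSq S).mul (HasPartials.const (horiz i j))).add
    ((hb.hasPartials_radiusSq S).mul ((hasPartials_hc S i p).mul (hasPartials_hc S j p)))).add
    ((hc'.hasPartials_radiusSq S).mul (HasPartials.const (if i = 2 ∧ j = 2 then 1 else 0)))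
  simp only [radialMetric_apply]
  convert h using 1
  ext m
  simp only [Pi.add_apply, Pi.smul_apply, smul_eq_mul, Pi.zero_apply]
  ring

theorem det_radialMetric (a b c : ℝ → ℝ) (p : Fin 3 → ℝ) :
    (radialMetric a b c p).det =
      a (radiusSq p) * (a (radiusSq p) + radiusSq p * b (radiusSq p)) * c (radiusSq p) := by
  rw [radialMetric, Matrix.det_fin_three]
  simp [radiusSq]
  ring

/-- The horizontal block has eigenvalue $a$ in the angular direction and $a+qb$ in the radial one,
and its inverse has the same shape. -/
theorem inv_radialMetric {a b c : ℝ → ℝ} {p : Fin 3 → ℝ} (ha : a (radiusSq p) ≠ 0)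
    (hab : a (radiusSq p) + radiusSq p * b (radiusSq p) ≠ 0) (hc : c (radiusSq p) ≠ 0) :
    (radialMetric a b c p)⁻¹ = radialMetric (fun q => (a q)⁻¹)
      (fun q => - b q / (a q * (a q + q * b q))) (fun q => (c q)⁻¹) p := by
  apply Matrix.inv_eq_right_inv
  have h2 : a (radiusSq p) + (p 0 ^ 2 + p 1 ^ 2) * b (radiusSq p) ≠ 0 := hab
  have hq : radiusSq p = p 0 ^ 2 + p 1 ^ 2 := rfl
  unfold radialMetric
  generalize radiusSq p = q at *
  subst hq
  ext i j
  fin_cases i <;> fin_cases j <;>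
    simp [Matrix.mul_apply, Fin.sum_univ_three] <;>
    first
    | (field_simp; done)
    | (field_simp; ring)

/-- The shape of the Christoffel symbols of `radialMetric`. -/
def radialChristoffel (c : Fin 5 → ℝ → ℝ) (l i j : Fin 3) (p : Fin 3 → ℝ) : ℝ :=
  c 0 (radiusSq p) * (horiz j l * hc i p + horiz i l * hc j p) +
    c 1 (radiusSq p) * (horiz i j * hc l p) +
    c 2 (radiusSq p) * (hc i p * hc j p * hc l p) +
    c 3 (radiusSq p) * (if l = 2 then (if i = 2 then hc j p else 0) + if j = 2 then hc i p else 0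
      else 0) +
    c 4 (radiusSq p) * (if i = 2 ∧ j = 2 then hc l p else 0)

/-- The coefficients `e` are characterised by products, so that they may be supplied in a form that
is visibly smooth across the axis. -/
theorem christoffel_radialMetric {S : Set (Fin 3 → ℝ)} {a b c : ℝ → ℝ} {a' b' c' : ℝ}
    {p : Fin 3 → ℝ} (hS : UniqueDiffWithinAt ℝ S p)
    (ha : HasDerivAt a a' (radiusSq p)) (hb : HasDerivAt b b' (radiusSq p))
    (hc' : HasDerivAt c c' (radiusSq p)) (ha0 : a (radiusSq p) ≠ 0)
    (hab : a (radiusSq p) + radiusSq p * b (radiusSq p) ≠ 0) (hc0 : c (radiusSq p) ≠ 0)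
    (e : Fin 5 → ℝ → ℝ)
    (h0 : a (radiusSq p) * e 0 (radiusSq p) = a')
    (h1 : (a (radiusSq p) + radiusSq p * b (radiusSq p)) * e 1 (radiusSq p) = b (radiusSq p) - a')
    (h2 : (a (radiusSq p) + radiusSq p * b (radiusSq p)) * e 2 (radiusSq p) =
      b' - 2 * e 0 (radiusSq p) * b (radiusSq p))
    (h3 : c (radiusSq p) * e 3 (radiusSq p) = c')
    (h4 : (a (radiusSq p) + radiusSq p * b (radiusSq p)) * e 4 (radiusSq p) = - c')
    (l i j : Fin 3) :
    christoffel S (radialMetric a b c) l i j p = radialChristoffel e l i j p := by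
  unfold christoffel
  simp only [(hasPartials_radialMetric ha hb hc' S _ _).pd_eq hS, inv_radialMetric ha0 hab hc0]
  have hq : radiusSq p = p 0 ^ 2 + p 1 ^ 2 := rfl
  simp only [radialChristoffel, radialMetric, Fin.sum_univ_three]
  generalize radiusSq p = q at *
  have e0 : e 0 q = a' / a q := by rw [eq_div_iff ha0, mul_comm]; exact h0
  have e1 : e 1 q = (b q - a') / (a q + q * b q) := by rw [eq_div_iff hab, mul_comm]; exact h1
  have e2 : e 2 q = (b' - 2 * (a' / a q) * b q) / (a q + q * b q) := by
    rw [← e0, eq_div_iff hab, mul_comm]; exact h2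
  have e3 : e 3 q = c' / c q := by rw [eq_div_iff hc0, mul_comm]; exact h3
  have e4 : e 4 q = -c' / (a q + q * b q) := by rw [eq_div_iff hab, mul_comm]; exact h4
  rw [e0, e1, e2, e3, e4]
  subst hq
  fin_cases l <;> fin_cases i <;> fin_cases j <;>
    simp [hc, horiz] <;> (try field_simp) <;> ring

theorem hasPartials_radialChristoffel {c : Fin 5 → ℝ → ℝ} {c' : Fin 5 → ℝ} {p : Fin 3 → ℝ}
    (h : ∀ i, HasDerivAt (c i) (c' i) (radiusSq p)) (S : Set (Fin 3 → ℝ)) (l i j : Fin 3) :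
    HasPartials S (radialChristoffel c l i j)
      (fun m => 2 * hc m p * radialChristoffel (fun i _ => c' i) l i j p +
        (c 0 (radiusSq p) * (horiz j l * horiz i m + horiz i l * horiz j m) +
        c 1 (radiusSq p) * (horiz i j * horiz l m) +
        c 2 (radiusSq p) * (horiz i m * hc j p * hc l p + hc i p * horiz j m * hc l p +
          hc i p * hc j p * horiz l m) +
        c 3 (radiusSq p) * (if l = 2 then (if i = 2 then horiz j m else 0) +
          if j = 2 then horiz i m else 0 else 0) +
        c 4 (radiusSq p) * (if i = 2 ∧ j = 2 then horiz l m else 0))) p := by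
  have hX := fun i => hasPartials_hc S i p
  have hC := fun (r : ℝ) => HasPartials.const (S := S) (p := p) r
  have h0 := ((h 0).hasPartials_radiusSq S).mul
    (((hC (horiz j l)).mul (hX i)).add ((hC (horiz i l)).mul (hX j)))
  have h1 := ((h 1).hasPartials_radiusSq S).mul ((hC (horiz i j)).mul (hX l))
  have h2 := ((h 2).hasPartials_radiusSq S).mul (((hX i).mul (hX j)).mul (hX l))
  have h3 := ((h 3).hasPartials_radiusSq S).mul ((hC (if l = 2 then 1 else 0)).mul
    (((hC (if i = 2 then 1 else 0)).mul (hX j)).add ((hC (if j = 2 then 1 else 0)).mul (hX i))))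
  have h4 := ((h 4).hasPartials_radiusSq S).mul ((hC (if i = 2 ∧ j = 2 then 1 else 0)).mul (hX l))
  have key := (((h0.add h1).add h2).add h3).add h4
  convert key using 1
  · ext q
    simp only [radialChristoffel]
    split_ifs <;> ring
  · ext m
    simp only [radialChristoffel, Pi.add_apply, Pi.smul_apply, smul_eq_mul, Pi.zero_apply]
    split_ifs <;> ring

/-- The symmetry of the symbols passes to the Ricci tensor, which has only three coefficients. The
formula for the symbols is assumed on all of `S` because it has to be differentiated. -/
theorem ricciCurvature_of_christoffel {S : Set (Fin 3 → ℝ)}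
    {g : (Fin 3 → ℝ) → Matrix (Fin 3) (Fin 3) ℝ} {c : Fin 5 → ℝ → ℝ} {c' : Fin 5 → ℝ}
    {p : Fin 3 → ℝ} (hS : UniqueDiffWithinAt ℝ S p) (hp : p ∈ S)
    (hΓ : ∀ q ∈ S, ∀ l i j, christoffel S g l i j q = radialChristoffel c l i j q)
    (h : ∀ i, HasDerivAt (c i) (c' i) (radiusSq p)) {q d0 d1 d2 d3 d4 : ℝ}
    (hq : q = radiusSq p) (h0 : c 0 q = d0) (h1 : c 1 q = d1) (h2 : c 2 q = d2) (h3 : c 3 q = d3)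
    (h4 : c 4 q = d4) (j k : Fin 3) :
    ricciCurvature S g j k p =
      (2 * d0 + 2 * d1 + 2 * q * c' 1 + (3 * d0 + d1 + q * d2 + d3) * (q * d1 - 1) -
        2 * d0 * d1 * q) * horiz j k +
      (4 * c' 0 + 4 * d2 + 2 * q * c' 2 - 2 * (3 * c' 0 + c' 1 + q * c' 2 + d2 + c' 3) +
        (3 * d0 + d1 + q * d2 + d3) * (2 * d0 + q * d2) -
        (5 * d0 ^ 2 + 2 * d0 * d1 + 4 * d0 * d2 * q + (d1 + q * d2) ^ 2 + d3 ^ 2)) *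
        (hc j p * hc k p) +
      (2 * d4 + 2 * q * c' 4 + (3 * d0 + d1 + q * d2 + d3) * q * d4 - 2 * d3 * d4 * q) *
        (if j = 2 ∧ k = 2 then 1 else 0) := by
  unfold ricciCurvature riemannCurvature
  have hpd : ∀ l i j m, pd S (christoffel S g l i j) m p = _ := fun l i j m =>
    ((hasPartials_radialChristoffel h S l i j).congr
      (eventually_nhdsWithin_of_forall fun q hq => hΓ q hq l i j) hp).pd_eq hS m
  simp only [hpd, hΓ p hp]
  simp only [Fin.sum_univ_three, radialChristoffel, ← hq, h0, h1, h2, h3, h4]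
  have hq' : q = p 0 ^ 2 + p 1 ^ 2 := hq
  clear hpd h hΓ
  subst hq'
  fin_cases j <;> fin_cases k <;> simp [horiz, hc, -mul_eq_mul_left_iff] <;> ring

/-! ### Curvature, positivity and normal form of the doubly warped metric. -/

/-- The metric `e^{-2u} (dr² + f² dθ²) + e^{2u} dt²` in Cartesian coordinates, where
`u = U(r²)` and `f = r (1 - r² ψ(r²))`. -/
noncomputable def warpedMetric (U ψ : ℝ → ℝ) : (Fin 3 → ℝ) → Matrix (Fin 3) (Fin 3) ℝ :=
  radialMetric (fun q => Real.exp (-2 * U q) * (1 - q * ψ q) ^ 2)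
    (fun q => Real.exp (-2 * U q) * (2 * ψ q - q * ψ q ^ 2)) (fun q => Real.exp (2 * U q))

/-- The coefficients of the Christoffel symbols of `warpedMetric`. -/
noncomputable def warpedCoeff (U ψ : ℝ → ℝ) : Fin 5 → ℝ → ℝ :=
  ![fun q => -2 * (ψ q + q * deriv ψ q) / (1 - q * ψ q) - 2 * deriv U q,
    fun q => 2 * ψ q - q * ψ q ^ 2 + 2 * (ψ q + q * deriv ψ q) * (1 - q * ψ q) +
      2 * deriv U q * (1 - q * ψ q) ^ 2,
    fun q => 2 * deriv ψ q - ψ q ^ 2 - 2 * q * ψ q * deriv ψ q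
      - 2 * deriv U q * (2 * ψ q - q * ψ q ^ 2)
      - 2 * (2 * ψ q - q * ψ q ^ 2) *
        (-2 * (ψ q + q * deriv ψ q) / (1 - q * ψ q) - 2 * deriv U q),
    fun q => 2 * deriv U q,
    fun q => -2 * deriv U q * Real.exp (4 * U q)]

theorem ContDiffAt.deriv_infty {f : ℝ → ℝ} {x : ℝ} (h : ContDiffAt ℝ ∞ f x) :
    ContDiffAt ℝ ∞ (deriv f) x := by
  have h1 : ContDiffAt ℝ ∞ (fderiv ℝ f) x := h.fderiv_right (by simp)
  exact h1.clm_apply contDiffAt_const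

theorem christoffel_warpedMetric {S : Set (Fin 3 → ℝ)} {U ψ : ℝ → ℝ} {p : Fin 3 → ℝ}
    (hS : UniqueDiffWithinAt ℝ S p) (hU : DifferentiableAt ℝ U (radiusSq p))
    (hψ : DifferentiableAt ℝ ψ (radiusSq p)) (hφ : 1 - radiusSq p * ψ (radiusSq p) ≠ 0)
    (l i j : Fin 3) :
    christoffel S (warpedMetric U ψ) l i j p = radialChristoffel (warpedCoeff U ψ) l i j p := by
  have e1 := (hU.hasDerivAt.const_mul (-2)).exp
  have e2 := (hU.hasDerivAt.const_mul 2).exp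
  have hid := hasDerivAt_id' (radiusSq p)
  have f1 := ((hid.fun_mul hψ.hasDerivAt).const_sub 1).fun_pow 2
  have f2 := (hψ.hasDerivAt.const_mul 2).fun_sub (hid.fun_mul (hψ.hasDerivAt.fun_pow 2))
  have E := Real.exp_ne_zero (-2 * U (radiusSq p))
  have hE : Real.exp (4 * U (radiusSq p)) * Real.exp (-2 * U (radiusSq p)) =
      Real.exp (2 * U (radiusSq p)) := by
    rw [← Real.exp_add]; ring_nf
  have hsum : Real.exp (-2 * U (radiusSq p)) * (1 - radiusSq p * ψ (radiusSq p)) ^ 2 + radiusSq p *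
      (Real.exp (-2 * U (radiusSq p)) * (2 * ψ (radiusSq p) - radiusSq p * ψ (radiusSq p) ^ 2)) =
      Real.exp (-2 * U (radiusSq p)) := by ring
  refine christoffel_radialMetric hS (e1.fun_mul f1) (e1.fun_mul f2) e2 ?_ ?_ (Real.exp_ne_zero _) _
    ?_ ?_ ?_ ?_ ?_ l i j
  · exact mul_ne_zero E (pow_ne_zero 2 hφ)
  · rw [hsum]; exact E
  case refine_6 => rfl
  all_goals
    simp only [hsum, warpedCoeff, Matrix.cons_val]
    generalize Real.exp (-2 * U (radiusSq p)) = E1 at *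
    generalize ψ (radiusSq p) = x at *
    generalize deriv ψ (radiusSq p) = x1 at *
    generalize radiusSq p = q at *
  · field_simp
    push_cast
    ring
  · push_cast; ring
  · field_simp
    push_cast
    ring
  · linear_combination (-2 * deriv U q) * hE

theorem forall_hasDerivAt_fin_five {c : Fin 5 → ℝ → ℝ} {x d0 d1 d2 d3 d4 : ℝ}
    (h0 : HasDerivAt (c 0) d0 x) (h1 : HasDerivAt (c 1) d1 x) (h2 : HasDerivAt (c 2) d2 x)
    (h3 : HasDerivAt (c 3) d3 x) (h4 : HasDerivAt (c 4) d4 x) :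
    ∀ i, HasDerivAt (c i) (![d0, d1, d2, d3, d4] i) x := by
  intro i
  fin_cases i
  exacts [h0, h1, h2, h3, h4]

/-- This is $2e^{2u}(-f''/f-u'^2)$ with $f=r\varphi(r^2)$, $\varphi=1-q\psi$: one has $u'^2=4qU'^2$,
$f''=r(6\varphi'+4q\varphi'')$, $\varphi'=-(\psi+q\psi')$ and $\varphi''=-(2\psi'+q\psi'')$. In the
variable $q$ nothing is singular on the axis. -/
theorem scalarCurvature_warpedMetric {S : Set (Fin 3 → ℝ)} {U ψ : ℝ → ℝ}
    (hS : UniqueDiffOn ℝ S) (hU : ∀ q, 0 ≤ q → ContDiffAt ℝ ∞ U q)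
    (hψ : ∀ q, 0 ≤ q → ContDiffAt ℝ ∞ ψ q) (hφ : ∀ p ∈ S, 1 - radiusSq p * ψ (radiusSq p) ≠ 0)
    {p : Fin 3 → ℝ} (hp : p ∈ S) {q : ℝ} (hq : q = radiusSq p) :
    scalarCurvature S (warpedMetric U ψ) p = 2 * Real.exp (2 * U q) *
      ((6 * (ψ q + q * deriv ψ q) + 4 * q * (2 * deriv ψ q + q * deriv (deriv ψ) q)) /
        (1 - q * ψ q) - 4 * q * deriv U q ^ 2) := by
  have hq0 : 0 ≤ q := hq ▸ radiusSq_nonneg p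
  have dU := fun q h => (hU q h).differentiableAt (by simp)
  have dψ := fun q h => (hψ q h).differentiableAt (by simp)
  have hφq : 1 - q * ψ q ≠ 0 := hq ▸ hφ p hp
  have hΓ : ∀ q ∈ S, ∀ l i j, christoffel S (warpedMetric U ψ) l i j q =
      radialChristoffel (warpedCoeff U ψ) l i j q := fun y hy l i j =>
    christoffel_warpedMetric (hS y hy) (dU _ (radiusSq_nonneg y)) (dψ _ (radiusSq_nonneg y))
      (hφ y hy) l i j
  have hU1 := (dU q hq0).hasDerivAt
  have hψ1 := (dψ q hq0).hasDerivAt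
  have hU2 : HasDerivAt (deriv U) (deriv (deriv U) q) q :=
    ((hU q hq0).deriv_infty.differentiableAt (by simp)).hasDerivAt
  have hψ2 : HasDerivAt (deriv ψ) (deriv (deriv ψ) q) q :=
    ((hψ q hq0).deriv_infty.differentiableAt (by simp)).hasDerivAt
  have hid := hasDerivAt_id' q
  have hD := (hid.fun_mul hψ1).const_sub 1
  have hN := hψ1.fun_add (hid.fun_mul hψ2)
  have hβ := (hψ1.const_mul 2).fun_sub (hid.fun_mul (hψ1.fun_pow 2))
  have k0 := ((hN.const_mul (-2)).fun_div hD hφq).fun_sub (hU2.const_mul 2)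
  have k1 := (hβ.fun_add ((hN.const_mul 2).fun_mul hD)).fun_add
    ((hU2.const_mul 2).fun_mul (hD.fun_pow 2))
  have k2 := ((((hψ2.const_mul 2).fun_sub (hψ1.fun_pow 2)).fun_sub
    (((hid.const_mul 2).fun_mul hψ1).fun_mul hψ2)).fun_sub ((hU2.const_mul 2).fun_mul hβ)).fun_sub
    ((hβ.const_mul 2).fun_mul k0)
  have k3 := hU2.const_mul 2
  have k4 := (hU2.const_mul (-2)).fun_mul ((hU1.const_mul 4).exp)
  have hc := forall_hasDerivAt_fin_five (c := warpedCoeff U ψ) k0 k1 k2 k3 k4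
  rw [hq] at hc
  have hR := ricciCurvature_of_christoffel (hS p hp) hp hΓ hc hq rfl rfl rfl rfl rfl
  have hinv : (warpedMetric U ψ p)⁻¹ = _ := inv_radialMetric
    (mul_ne_zero (Real.exp_ne_zero _) (pow_ne_zero 2 (hφ p hp)))
    (by
      have := Real.exp_ne_zero (-2 * U (radiusSq p))
      convert this using 1
      ring) (Real.exp_ne_zero _)
  unfold scalarCurvature
  simp only [hR, hinv, radialMetric, ← hq]
  have hq' : q = p 0 ^ 2 + p 1 ^ 2 := hq
  have hE4 : Real.exp (4 * U q) = Real.exp (2 * U q) ^ 2 := by rw [← Real.exp_nat_mul]; ring_nf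
  have hE2 : Real.exp (-2 * U q) = (Real.exp (2 * U q))⁻¹ := by rw [← Real.exp_neg]; ring_nf
  have hE0 := Real.exp_ne_zero (2 * U q)
  simp only [warpedCoeff, Matrix.cons_val, hE4, hE2]
  clear hR hinv hc k0 k1 k2 k3 k4 hβ hN hD hid hψ2 hU2 hψ1 hU1 hΓ hE2 hE4 dU dψ hU hψ hφ
  generalize Real.exp (2 * U q) = E at *
  generalize ψ q = x at *
  generalize deriv (deriv ψ) q = x2 at *
  generalize deriv ψ q = x1 at *
  generalize deriv (deriv U) q = u2 at *
  generalize deriv U q = u1 at *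
  simp [Fin.sum_univ_three, horiz, Drawstring.hc]
  have hs : (E⁻¹ * (1 - q * x) ^ 2 + q * (E⁻¹ * (2 * x - q * x ^ 2))) = E⁻¹ := by ring
  rw [hs]
  subst hq'
  field_simp
  ring

theorem HasPartials.of_eq {n : ℕ} {S : Set (Fin n → ℝ)} {F : (Fin n → ℝ) → ℝ} {d e : Fin n → ℝ}
    {p : Fin n → ℝ} (h : HasPartials S F d p) (hde : ∀ i, d i = e i) : HasPartials S F e p :=
  funext hde ▸ h

theorem contDiff_radiusSq : ContDiff ℝ ∞ radiusSq := by
  unfold radiusSq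
  fun_prop

theorem convex_solidCylinder (ρ : ℝ) : Convex ℝ (solidCylinder ρ) := by
  have h : ∀ p : Fin 3 → ℝ, radius p = ‖(!₂[p 0, p 1] : EuclideanSpace ℝ (Fin 2))‖ := by
    intro p
    simp [radius, EuclideanSpace.norm_eq]
  intro p hp q hq a b ha hb hab
  simp only [solidCylinder, mem_ofPred_eq, h] at *
  have : (!₂[(a • p + b • q) 0, (a • p + b • q) 1] : EuclideanSpace ℝ (Fin 2)) =
      a • !₂[p 0, p 1] + b • !₂[q 0, q 1] := by
    ext i; fin_cases i <;> simp
  rw [this]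
  calc _ ≤ a * ‖(!₂[p 0, p 1] : EuclideanSpace ℝ (Fin 2))‖ +
      b * ‖(!₂[q 0, q 1] : EuclideanSpace ℝ (Fin 2))‖ := by
        refine (norm_add_le _ _).trans (le_of_eq ?_)
        rw [norm_smul, norm_smul, Real.norm_of_nonneg ha, Real.norm_of_nonneg hb]
    _ ≤ a * ρ + b * ρ := by gcongr
    _ = ρ := by rw [← add_mul, hab, one_mul]

theorem continuous_radius : Continuous radius := by
  unfold radius
  fun_prop

theorem uniqueDiffOn_solidCylinder {ρ : ℝ} (hρ : 0 < ρ) : UniqueDiffOn ℝ (solidCylinder ρ) := by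
  refine uniqueDiffOn_convex (convex_solidCylinder ρ) ⟨0, ?_⟩
  refine interior_maximal (t := {p | radius p < ρ}) (fun p (hp : radius p < ρ) => hp.le)
    (isOpen_lt continuous_radius continuous_const) ?_
  simpa [radius] using hρ

theorem isRiemannianMetricOn_warpedMetric {S : Set (Fin 3 → ℝ)} {U ψ : ℝ → ℝ}
    (hU : ∀ q, 0 ≤ q → ContDiffAt ℝ ∞ U q)
    (hψ : ∀ q, 0 ≤ q → ContDiffAt ℝ ∞ ψ q)
    (hφ : ∀ p ∈ S, 1 - radiusSq p * ψ (radiusSq p) ≠ 0) :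
    IsRiemannianMetricOn S (warpedMetric U ψ) where
  smooth i j p _ := by
    apply ContDiffAt.contDiffWithinAt
    have hq := contDiff_radiusSq.contDiffAt (x := p)
    have h1 := (hU _ (radiusSq_nonneg p)).comp p hq
    have h2 := (hψ _ (radiusSq_nonneg p)).comp p hq
    simp only [Function.comp_def] at h1 h2
    clear hU hψ
    obtain ⟨a, ha⟩ : ∃ a : (Fin 3 → ℝ) → ℝ, ∀ p, U (radiusSq p) = a p := ⟨_, fun _ => rfl⟩
    obtain ⟨b, hb⟩ : ∃ b : (Fin 3 → ℝ) → ℝ, ∀ p, ψ (radiusSq p) = b p := ⟨_, fun _ => rfl⟩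
    simp only [ha, hb] at h1 h2
    fin_cases i <;> fin_cases j <;> simp [warpedMetric, radialMetric, ha, hb] <;> fun_prop
  posDef p hp := by
    refine Matrix.PosDef.of_dotProduct_mulVec_pos ?_ ?_
    · ext i j
      fin_cases i <;> fin_cases j <;> simp [warpedMetric, radialMetric]
    · intro v hv
      have hE := Real.exp_pos (-2 * U (radiusSq p))
      have hE' := Real.exp_pos (2 * U (radiusSq p))
      have hD := hφ p hp
      simp only [warpedMetric, radialMetric, Matrix.mulVec, dotProduct, Fin.sum_univ_three,
        Matrix.of_apply, Matrix.cons_val, star_trivial]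
      have hv' : v 0 ^ 2 + v 1 ^ 2 ≠ 0 ∨ v 2 ≠ 0 := by
        by_contra! h
        apply hv
        ext i
        fin_cases i <;> simp <;> nlinarith [h.1, h.2, sq_nonneg (v 0), sq_nonneg (v 1)]
      have hq : radiusSq p = p 0 ^ 2 + p 1 ^ 2 := rfl
      generalize Real.exp (-2 * U (radiusSq p)) = E at *
      generalize Real.exp (2 * U (radiusSq p)) = E' at *
      generalize ψ (radiusSq p) = x at *
      generalize radiusSq p = q at *
      subst hq
      have key : 0 ≤ (1 - (p 0 ^ 2 + p 1 ^ 2) * x) ^ 2 * (v 0 ^ 2 + v 1 ^ 2) +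
          (2 * x - (p 0 ^ 2 + p 1 ^ 2) * x ^ 2) * (v 0 * p 0 + v 1 * p 1) ^ 2 ∧
          (v 0 ^ 2 + v 1 ^ 2 ≠ 0 → 0 < (1 - (p 0 ^ 2 + p 1 ^ 2) * x) ^ 2 * (v 0 ^ 2 + v 1 ^ 2) +
          (2 * x - (p 0 ^ 2 + p 1 ^ 2) * x ^ 2) * (v 0 * p 0 + v 1 * p 1) ^ 2) := by
        rcases (show 0 ≤ p 0 ^ 2 + p 1 ^ 2 by positivity).eq_or_lt with h0 | h0
        · have h1 : p 0 = 0 := by nlinarith [sq_nonneg (p 0), sq_nonneg (p 1)]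
          have h2 : p 1 = 0 := by nlinarith [sq_nonneg (p 0), sq_nonneg (p 1)]
          simp only [h1, h2]
          refine ⟨by ring_nf; positivity, fun h => ?_⟩
          have : 0 < v 0 ^ 2 + v 1 ^ 2 := lt_of_le_of_ne (by positivity) h.symm
          linarith
        -- Off the axis, multiplying by $|x|^2$ splits the form into its angular part, weighted by
        -- $\varphi^2$, and its radial part.
        · have key : (p 0 ^ 2 + p 1 ^ 2) * ((1 - (p 0 ^ 2 + p 1 ^ 2) * x) ^ 2 *
              (v 0 ^ 2 + v 1 ^ 2) +
              (2 * x - (p 0 ^ 2 + p 1 ^ 2) * x ^ 2) * (v 0 * p 0 + v 1 * p 1) ^ 2) =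
              (1 - (p 0 ^ 2 + p 1 ^ 2) * x) ^ 2 * (v 0 * p 1 - v 1 * p 0) ^ 2 +
              (v 0 * p 0 + v 1 * p 1) ^ 2 := by ring
          constructor
          · refine le_of_mul_le_mul_left ?_ h0
            rw [key, mul_zero]; positivity
          · intro h
            have hv : 0 < v 0 ^ 2 + v 1 ^ 2 := lt_of_le_of_ne (by positivity) h.symm
            refine lt_of_mul_lt_mul_left ?_ h0.le
            rw [key, mul_zero]
            have hsum : (v 0 * p 1 - v 1 * p 0) ^ 2 + (v 0 * p 0 + v 1 * p 1) ^ 2 =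
              (p 0 ^ 2 + p 1 ^ 2) * (v 0 ^ 2 + v 1 ^ 2) := by ring
            have hpos : 0 < (p 0 ^ 2 + p 1 ^ 2) * (v 0 ^ 2 + v 1 ^ 2) := by positivity
            by_cases hz : v 0 * p 0 + v 1 * p 1 = 0
            · have : v 0 * p 1 - v 1 * p 0 ≠ 0 := by
                intro hz'
                rw [hz, hz'] at hsum
                simp at hsum
                exact hsum.elim h0.ne' h
              positivity
            · positivity
      have : 0 ≤ E' * v 2 ^ 2 := by positivity
      rcases hv' with h | h
      · nlinarith [mul_pos hE (key.2 h)]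
      · have : 0 < E' * v 2 ^ 2 := by positivity
        nlinarith [mul_nonneg hE.le key.1]

/-- The factor $e^{-2u}$ of the horizontal area element meets $e^{u}$ from the vertical direction,
leaving $e^{-u}\varphi$. -/
theorem det_warpedMetric (U ψ : ℝ → ℝ) (p : Fin 3 → ℝ) : √(warpedMetric U ψ p).det =
    Real.exp (-U (radiusSq p)) * |1 - radiusSq p * ψ (radiusSq p)| := by
  rw [warpedMetric, det_radialMetric, ← Real.sqrt_sq (Real.exp_pos (-U (radiusSq p))).le,
    ← Real.sqrt_sq_eq_abs, ← Real.sqrt_mul (sq_nonneg _), ← Real.exp_nat_mul]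
  congr 1
  have h : Real.exp (-2 * U (radiusSq p)) * Real.exp (2 * U (radiusSq p)) = 1 := by
    rw [← Real.exp_add]; simp
  have h2 : Real.exp ((2 : ℕ) * -U (radiusSq p)) = Real.exp (-2 * U (radiusSq p)) := by
    push_cast; ring_nf
  rw [h2]
  linear_combination (Real.exp (-2 * U (radiusSq p)) * (1 - radiusSq p * ψ (radiusSq p)) ^ 2) * h

theorem hasDoublyWarpedForm_warpedMetric (ρ : ℝ) (U ψ : ℝ → ℝ) :
    HasDoublyWarpedForm ρ (fun r => U (r ^ 2)) (fun r => r * (1 - r ^ 2 * ψ (r ^ 2)))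
      (warpedMetric U ψ) := by
  intro q _
  have h0 : HasPartials univ (fun q => cylindrical q 0)
      ![Real.cos (q 1), -q 0 * Real.sin (q 1), 0] q := by
    have := (HasPartials.coord (S := univ) (p := q) 0).mul
      (HasPartials.comp (Real.hasDerivAt_cos (q 1)) (HasPartials.coord (S := univ) 1))
    exact this.of_eq fun i => by fin_cases i <;> simp
  have h1 : HasPartials univ (fun q => cylindrical q 1)
      ![Real.sin (q 1), q 0 * Real.cos (q 1), 0] q := by
    have := (HasPartials.coord (S := univ) (p := q) 0).mul
      (HasPartials.comp (Real.hasDerivAt_sin (q 1)) (HasPartials.coord (S := univ) 1))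
    exact this.of_eq fun i => by fin_cases i <;> simp
  have h2 : HasPartials univ (fun q => cylindrical q 2) (Pi.single 2 1) q :=
    HasPartials.coord (S := univ) 2
  have hJ : jacobian univ cylindrical q = !![Real.cos (q 1), -q 0 * Real.sin (q 1), 0;
      Real.sin (q 1), q 0 * Real.cos (q 1), 0; 0, 0, 1] := by
    ext a i
    simp only [jacobian, Matrix.of_apply]
    have hu := uniqueDiffWithinAt_univ (𝕜 := ℝ) (x := q)
    fin_cases a
    · simp only [Fin.zero_eta]
      rw [h0.pd_eq hu]; fin_cases i <;> simp
    · simp only [Fin.mk_one]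
      rw [h1.pd_eq hu]; fin_cases i <;> simp
    · simp only [Fin.reduceFinMk]
      rw [h2.pd_eq hu]; fin_cases i <;> simp
  have hr : radiusSq (cylindrical q) = q 0 ^ 2 := by
    simp only [radiusSq, cylindrical, Matrix.cons_val]
    linear_combination q 0 ^ 2 * Real.sin_sq_add_cos_sq (q 1)
  rw [pullback, hJ, warpedMetric, radialMetric, hr]
  have hcs := Real.sin_sq_add_cos_sq (q 1)
  have e1 : Real.sin (q 1) ^ 2 = 1 - Real.cos (q 1) ^ 2 := by linarith
  simp only [cylindrical, Matrix.cons_val]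
  generalize Real.exp (-2 * U (q 0 ^ 2)) = E
  generalize Real.exp (2 * U (q 0 ^ 2)) = E'
  generalize ψ (q 0 ^ 2) = x
  generalize Real.sin (q 1) = s at *
  generalize Real.cos (q 1) = c at *
  generalize q 0 = r at *
  ext i j
  fin_cases i <;> fin_cases j <;>
    simp [Matrix.mul_apply, Fin.sum_univ_three, Matrix.diagonal] <;>
    ring_nf
  · linear_combination (E * ((1 - (1 - r ^ 2 * x) ^ 2) * (s ^ 2 + c ^ 2 + 1) +
      (1 - r ^ 2 * x) ^ 2)) * hcs
  · linear_combination (E * r ^ 2 * (1 - r ^ 2 * x) ^ 2) * hcs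

theorem hasPartials_radius {S : Set (Fin 3 → ℝ)} {p : Fin 3 → ℝ} (hp : 0 < radius p) :
    HasPartials S radius (fun m => hc m p / radius p) p := by
  have h : radiusSq p ≠ 0 := by rw [← radius_sq]; positivity
  have := HasPartials.comp (Real.hasDerivAt_sqrt h) (hasPartials_radiusSq S p)
  refine this.of_eq fun m => ?_
  simp [radius_eq]
  ring

theorem inv_warpedMetric {U ψ : ℝ → ℝ} {p : Fin 3 → ℝ}
    (hφ : 1 - radiusSq p * ψ (radiusSq p) ≠ 0) :
    (warpedMetric U ψ p)⁻¹ = radialMetric (fun q => Real.exp (2 * U q) / (1 - q * ψ q) ^ 2)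
      (fun q => - Real.exp (2 * U q) * (2 * ψ q - q * ψ q ^ 2) / (1 - q * ψ q) ^ 2)
      (fun q => (Real.exp (2 * U q))⁻¹) p := by
  have hE2 : Real.exp (-2 * U (radiusSq p)) = (Real.exp (2 * U (radiusSq p)))⁻¹ := by
    rw [← Real.exp_neg]; ring_nf
  have hs : Real.exp (-2 * U (radiusSq p)) * (1 - radiusSq p * ψ (radiusSq p)) ^ 2 + radiusSq p *
      (Real.exp (-2 * U (radiusSq p)) * (2 * ψ (radiusSq p) - radiusSq p * ψ (radiusSq p) ^ 2)) =
      Real.exp (-2 * U (radiusSq p)) := by ring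
  rw [warpedMetric, inv_radialMetric]
  rotate_left
  · exact mul_ne_zero (Real.exp_ne_zero _) (pow_ne_zero 2 hφ)
  · rw [hs]; exact Real.exp_ne_zero _
  · exact Real.exp_ne_zero _
  have hE0 := Real.exp_ne_zero (2 * U (radiusSq p))
  simp only [radialMetric, hs]
  simp only [hE2]
  generalize Real.exp (2 * U (radiusSq p)) = E at *
  generalize ψ (radiusSq p) = x at *
  generalize radiusSq p = q at *
  ext i j
  fin_cases i <;> fin_cases j <;> simp [-mul_eq_mul_right_iff] <;> field_simp

/-- Since $|\partial_r|_g=e^{-u}$, the gradient of $r$ is $e^{2u}\partial_r$ and the unit normal is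
$e^u\partial_r$. -/
theorem unitNormal_warpedMetric {S : Set (Fin 3 → ℝ)} {U ψ : ℝ → ℝ} {p : Fin 3 → ℝ}
    (hS : UniqueDiffWithinAt ℝ S p) (hφ : 1 - radiusSq p * ψ (radiusSq p) ≠ 0)
    (hp : 0 < radius p) (i : Fin 3) :
    unitNormal S (warpedMetric U ψ) radius p i =
      Real.exp (U (radiusSq p)) / √(radiusSq p) * hc i p := by
  have hq : radiusSq p = p 0 ^ 2 + p 1 ^ 2 := rfl
  have hr : √(radiusSq p) = radius p := rfl
  have hr2 := radius_sq p
  have hE2 : Real.exp (-2 * U (radiusSq p)) = (Real.exp (U (radiusSq p)) ^ 2)⁻¹ := by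
    rw [← Real.exp_nat_mul, ← Real.exp_neg]; push_cast; ring_nf
  have hE1 : Real.exp (2 * U (radiusSq p)) = Real.exp (U (radiusSq p)) ^ 2 := by
    rw [← Real.exp_nat_mul]; push_cast; ring_nf
  have hE0 := Real.exp_pos (U (radiusSq p))
  have hgrad : metricGradient S (warpedMetric U ψ) radius p =
      fun i => Real.exp (U (radiusSq p)) ^ 2 / radius p * hc i p := by
    unfold metricGradient
    simp only [(hasPartials_radius hp).pd_eq hS, inv_warpedMetric hφ, radialMetric, hE1]
    generalize Real.exp (U (radiusSq p)) = E at *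
    generalize ψ (radiusSq p) = x at *
    generalize radiusSq p = q at *
    have hφ' : 1 - x * q ≠ 0 := by rwa [mul_comm]
    ext i
    fin_cases i <;> simp [Matrix.mulVec, dotProduct, Fin.sum_univ_three, hc] <;> field_simp <;>
      simp only [hq] <;> ring
  have hnorm : √(metricGradient S (warpedMetric U ψ) radius p ⬝ᵥ
      (warpedMetric U ψ p *ᵥ metricGradient S (warpedMetric U ψ) radius p)) =
      Real.exp (U (radiusSq p)) := by
    rw [← Real.sqrt_sq hE0.le, hgrad]
    congr 1
    simp only [warpedMetric, radialMetric, hE1, hE2]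
    generalize Real.exp (U (radiusSq p)) = E at *
    generalize ψ (radiusSq p) = x at *
    generalize radiusSq p = q at *
    simp [Matrix.mulVec, dotProduct, Fin.sum_univ_three, hc]
    field_simp
    rw [hr2, hq]
    ring
  rw [unitNormal, hnorm, hgrad, hr]
  simp only [Pi.smul_apply, smul_eq_mul]
  field_simp

/-- The area density of the cylinder is $(e^{-u}f)\,e^u=f$, so the mean curvature is $e^uf'/f$, with
$f'=\varphi+2q\varphi'$. The potential does not affect its sign. -/
theorem meanCurvature_warpedMetric {S : Set (Fin 3 → ℝ)} {U ψ : ℝ → ℝ}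
    (hS : UniqueDiffOn ℝ S) (hU : ∀ q, 0 ≤ q → ContDiffAt ℝ ∞ U q)
    (hψ : ∀ q, 0 ≤ q → ContDiffAt ℝ ∞ ψ q) (hφ : ∀ p ∈ S, 1 - radiusSq p * ψ (radiusSq p) ≠ 0)
    {p : Fin 3 → ℝ} (hp : p ∈ S) (hr : 0 < radius p) {q : ℝ} (hq : q = radiusSq p) :
    meanCurvature S (warpedMetric U ψ) radius p = Real.exp (U q) / √q *
      (((1 - q * ψ q) - 2 * q * (ψ q + q * deriv ψ q)) / (1 - q * ψ q)) := by
  have hq0 : 0 < q := by rw [hq, ← radius_sq]; positivity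
  have dU := (hU q hq0.le).differentiableAt (by simp)
  have dψ := (hψ q hq0.le).differentiableAt (by simp)
  have hN := (dU.hasDerivAt.exp).fun_div (Real.hasDerivAt_sqrt hq0.ne') (by positivity)
  have hpd : ∀ i m, pd S (fun y => unitNormal S (warpedMetric U ψ) radius y i) m p = _ :=
    fun i m => (((hq ▸ hN).hasPartials_radiusSq S).mul (hasPartials_hc S i p)).congr
      (by
        filter_upwards [self_mem_nhdsWithin, mem_nhdsWithin_of_mem_nhds
          (continuous_radius.continuousAt.eventually (lt_mem_nhds hr))] with y hy hy'
        exact unitNormal_warpedMetric (hS y hy) (hφ y hy) hy' i) hp |>.pd_eq (hS p hp) m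
  have hq' : q = p 0 ^ 2 + p 1 ^ 2 := hq
  have hφq : 1 - q * ψ q ≠ 0 := hq ▸ hφ p hp
  unfold meanCurvature
  simp only [hpd, unitNormal_warpedMetric (hS p hp) (hφ p hp) hr, ← hq,
    christoffel_warpedMetric (hS p hp) (hq ▸ dU) (hq ▸ dψ) (hφ p hp)]
  have hs : √q ^ 2 = q := Real.sq_sqrt hq0.le
  have hs0 : 0 < √q := Real.sqrt_pos.2 hq0
  simp only [Fin.sum_univ_three, radialChristoffel, ← hq, warpedCoeff, Matrix.cons_val]
  generalize Real.exp (U q) = E at *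
  generalize ψ q = x at *
  generalize deriv ψ q = x1 at *
  generalize deriv U q = u1 at *
  simp [horiz, hc]
  have hφ' : 1 - x * q ≠ 0 := by rwa [mul_comm]
  field_simp
  simp only [hs]
  subst hq'
  ring

/-! ### Generalized trigonometry and the distance function of the space form. -/

/-- The generalized sine and cosine of curvature `k`. -/
structure IsModelPair (k : ℝ) (sn cn : ℝ → ℝ) : Prop where
  hasDerivAt_sn : ∀ x, HasDerivAt sn (cn x) x
  hasDerivAt_cn : ∀ x, HasDerivAt cn (-k * sn x) x
  contDiff_sn : ContDiff ℝ ∞ sn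
  contDiff_cn : ContDiff ℝ ∞ cn
  sn_zero : sn 0 = 0
  cn_zero : cn 0 = 1
  sq_add_sq : ∀ x, cn x ^ 2 + k * sn x ^ 2 = 1
  sn_two_mul : ∀ x, sn (2 * x) = 2 * sn x * cn x

theorem exists_isModelPair (k : ℝ) : ∃ sn cn, IsModelPair k sn cn := by
  rcases lt_trichotomy k 0 with hk | rfl | hk
  · set a := √(-k) with ha
    have ha2 : a ^ 2 = -k := Real.sq_sqrt (by linarith)
    have ha0 : a ≠ 0 := (Real.sqrt_pos.2 (by linarith)).ne'
    refine ⟨fun x => Real.sinh (a * x) / a, fun x => Real.cosh (a * x), ?_, ?_, ?_, ?_, ?_, ?_, ?_,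
      ?_⟩
    · intro x
      have := (((hasDerivAt_id' x).const_mul a).sinh).div_const a
      exact this.congr_deriv (by field_simp)
    · intro x
      have := (((hasDerivAt_id' x).const_mul a).cosh)
      exact this.congr_deriv (by rw [← ha2]; field_simp)
    · exact (Real.contDiff_sinh.comp (contDiff_const.mul contDiff_id)).div_const a
    · exact Real.contDiff_cosh.comp (contDiff_const.mul contDiff_id)
    · simp
    · simp
    · intro x
      have : k = -a ^ 2 := by linarith
      rw [Real.cosh_sq, this]; field_simp; ring
    · intro x
      rw [mul_left_comm, Real.sinh_two_mul]; ring
  · refine ⟨fun x => x, fun _ => 1, fun x => hasDerivAt_id' x, fun x => ?_, contDiff_id,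
      contDiff_const, rfl, rfl, fun x => by simp, fun x => by simp⟩
    simpa using hasDerivAt_const x (1 : ℝ)
  · set a := √k with ha
    have ha2 : a ^ 2 = k := Real.sq_sqrt hk.le
    have ha0 : a ≠ 0 := (Real.sqrt_pos.2 hk).ne'
    refine ⟨fun x => Real.sin (a * x) / a, fun x => Real.cos (a * x), ?_, ?_, ?_, ?_, ?_, ?_, ?_,
      ?_⟩
    · intro x
      have := (((hasDerivAt_id' x).const_mul a).sin).div_const a
      exact this.congr_deriv (by field_simp)
    · intro x
      have := (((hasDerivAt_id' x).const_mul a).cos)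
      exact this.congr_deriv (by rw [← ha2]; field_simp)
    · exact (Real.contDiff_sin.comp (contDiff_const.mul contDiff_id)).div_const a
    · exact Real.contDiff_cos.comp (contDiff_const.mul contDiff_id)
    · simp
    · simp
    · intro x
      rw [Real.cos_sq', ← ha2]; field_simp; ring
    · intro x
      rw [mul_left_comm, Real.sin_two_mul]; ring

/-- The distance to the origin in the space form, as a function of the Euclidean distance in the
conformal coordinate. -/
noncomputable def modelLength (k s : ℝ) : ℝ := ∫ t in (0 : ℝ)..s, (1 + k / 4 * t ^ 2)⁻¹

/-- The Euclidean distances to the origin in the conformal coordinate. -/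
def modelInterval (k : ℝ) : Set ℝ := {s | 0 < 1 + k / 4 * s ^ 2}

theorem mem_modelInterval_of_sq_le {k s t : ℝ} (hs : s ∈ modelInterval k) (h : t ^ 2 ≤ s ^ 2) :
    t ∈ modelInterval k := by
  simp only [modelInterval, mem_ofPred_eq] at *
  rcases le_total 0 k with hk | hk
  · positivity
  · nlinarith

theorem zero_mem_modelInterval (k : ℝ) : (0 : ℝ) ∈ modelInterval k := by simp [modelInterval]

theorem isOpen_modelInterval (k : ℝ) : IsOpen (modelInterval k) :=
  isOpen_lt continuous_const (by fun_prop)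

theorem convex_modelInterval (k : ℝ) : Convex ℝ (modelInterval k) := by
  rw [convex_iff_ordConnected]
  refine ⟨fun a ha b hb c hc => ?_⟩
  rcases le_total 0 c with h | h
  · exact mem_modelInterval_of_sq_le hb (by nlinarith [hc.2])
  · exact mem_modelInterval_of_sq_le ha (by nlinarith [hc.1])

theorem continuousOn_inv_modelInterval (k : ℝ) :
    ContinuousOn (fun t : ℝ => (1 + k / 4 * t ^ 2)⁻¹) (modelInterval k) :=
  ContinuousOn.inv₀ (by fun_prop) fun _ ht => ne_of_gt ht

theorem hasDerivAt_modelLength {k s : ℝ} (hs : s ∈ modelInterval k) :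
    HasDerivAt (modelLength k) (1 + k / 4 * s ^ 2)⁻¹ s := by
  have hsub : uIcc 0 s ⊆ modelInterval k :=
    (convex_modelInterval k).ordConnected.uIcc_subset (zero_mem_modelInterval k) hs
  refine intervalIntegral.integral_hasDerivAt_right
    ((continuousOn_inv_modelInterval k).mono hsub).intervalIntegrable ?_
    ((continuousOn_inv_modelInterval k).continuousAt ((isOpen_modelInterval k).mem_nhds hs))
  exact (continuousOn_inv_modelInterval k).stronglyMeasurableAtFilter (isOpen_modelInterval k) _ hs

theorem modelLength_zero (k : ℝ) : modelLength k 0 = 0 := by simp [modelLength]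

theorem strictMonoOn_modelLength (k : ℝ) : StrictMonoOn (modelLength k) (modelInterval k) := by
  refine strictMonoOn_of_deriv_pos (convex_modelInterval k)
    (fun s hs => (hasDerivAt_modelLength hs).continuousAt.continuousWithinAt) fun s hs => ?_
  rw [(isOpen_modelInterval k).interior_eq] at hs
  rw [(hasDerivAt_modelLength hs).deriv]
  exact inv_pos.2 hs

theorem contDiffOn_modelLength (k : ℝ) : ContDiffOn ℝ ∞ (modelLength k) (modelInterval k) := by
  rw [contDiffOn_infty_iff_deriv_of_isOpen (isOpen_modelInterval k)]
  refine ⟨fun s hs => (hasDerivAt_modelLength hs).differentiableAt.differentiableWithinAt, ?_⟩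
  have : ContDiffOn ℝ ∞ (fun t : ℝ => (1 + k / 4 * t ^ 2)⁻¹) (modelInterval k) :=
    ContDiffOn.inv (by fun_prop) fun _ ht => ne_of_gt ht
  exact this.congr fun s hs => (hasDerivAt_modelLength hs).deriv

/-- The Euclidean norm of the conformal coordinate. -/
noncomputable def planeNorm (z : Fin 2 → ℝ) : ℝ := √(z 0 ^ 2 + z 1 ^ 2)

theorem planeNorm_sq (z : Fin 2 → ℝ) : planeNorm z ^ 2 = z 0 ^ 2 + z 1 ^ 2 :=
  Real.sq_sqrt (by positivity)

theorem planeNorm_nonneg (z : Fin 2 → ℝ) : 0 ≤ planeNorm z := Real.sqrt_nonneg _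

theorem mem_spaceFormDomain_iff {k : ℝ} {z : Fin 2 → ℝ} :
    z ∈ spaceFormDomain k ↔ planeNorm z ∈ modelInterval k := by
  simp [spaceFormDomain, modelInterval, planeNorm_sq]

theorem spaceForm_speed {k : ℝ} {z v : Fin 2 → ℝ} (hz : z ∈ spaceFormDomain k) :
    √(v ⬝ᵥ (spaceFormMetric k z *ᵥ v)) = (1 + k / 4 * planeNorm z ^ 2)⁻¹ * planeNorm v := by
  have hz' : 0 < 1 + k / 4 * (z 0 ^ 2 + z 1 ^ 2) := hz
  rw [planeNorm_sq, planeNorm, ← Real.sqrt_sq (inv_pos.2 hz').le, ← Real.sqrt_mul (sq_nonneg _)]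
  congr 1
  simp [spaceFormMetric, spaceFormFactor, Matrix.mulVec, dotProduct, Fin.sum_univ_two]
  ring

/-- The radial segment from `z` to the origin realises this length. -/
theorem spaceFormDist_le {k : ℝ} {z : Fin 2 → ℝ} (hz : z ∈ spaceFormDomain k) :
    spaceFormDist k z ≤ ENNReal.ofReal (modelLength k (planeNorm z)) := by
  have hm := mem_spaceFormDomain_iff.1 hz
  have hn : ∀ s : ℝ, planeNorm ((1 - s) • z) ^ 2 = (1 - s) ^ 2 * planeNorm z ^ 2 := by
    intro s
    simp only [planeNorm_sq, Pi.smul_apply, smul_eq_mul]; ring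
  have hd : ∀ s ∈ Icc (0 : ℝ) 1, (1 - s) • z ∈ spaceFormDomain k := by
    intro s hs
    rw [mem_spaceFormDomain_iff]
    refine mem_modelInterval_of_sq_le hm ?_
    rw [hn]
    have : (1 - s) ^ 2 ≤ 1 := by nlinarith [hs.1, hs.2]
    nlinarith [sq_nonneg (planeNorm z)]
  refine (iInf₂_le (fun s : ℝ => (1 - s) • z) ⟨?_, hd, by simp, by simp⟩).trans ?_
  swap
  · fun_prop
  unfold pathLength
  have hder : ∀ s : ℝ, HasDerivAt (fun s : ℝ => (1 - s) • z) (-z) s := by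
    intro s
    simpa using ((hasDerivAt_id' s).const_sub 1).smul_const z
  have hF : ∀ s ∈ Icc (0 : ℝ) 1, HasDerivAt (fun s => -modelLength k ((1 - s) * planeNorm z))
      ((1 + k / 4 * ((1 - s) * planeNorm z) ^ 2)⁻¹ * planeNorm z) s := by
    intro s hs
    have h1 : (1 - s) * planeNorm z ∈ modelInterval k := by
      have := mem_spaceFormDomain_iff.1 (hd s hs)
      refine mem_modelInterval_of_sq_le this ?_
      rw [hn, mul_pow]
    have := ((hasDerivAt_modelLength h1).comp s
      (((hasDerivAt_id' s).const_sub 1).mul_const (planeNorm z))).neg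
    exact this.congr_deriv (by ring)
  have hcont : ContinuousOn (fun s => (1 + k / 4 * ((1 - s) * planeNorm z) ^ 2)⁻¹ * planeNorm z)
      (Icc 0 1) := by
    refine ContinuousOn.mul (ContinuousOn.inv₀ (by fun_prop) fun s hs => ?_) continuousOn_const
    have := hd s hs
    rw [mem_spaceFormDomain_iff, modelInterval, mem_ofPred_eq, hn, ← mul_pow] at this
    exact this.ne'
  have hint := intervalIntegral.integral_eq_sub_of_hasDerivAt
    (fun s hs => hF s (by rwa [uIcc_of_le zero_le_one] at hs))
    (ContinuousOn.intervalIntegrable_of_Icc zero_le_one hcont)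
  rw [intervalIntegral.integral_of_le zero_le_one, ← integral_Icc_eq_integral_Ioc] at hint
  have hint2 : ∫ s in Icc (0 : ℝ) 1, (1 + k / 4 * ((1 - s) * planeNorm z) ^ 2)⁻¹ * planeNorm z =
      modelLength k (planeNorm z) := by
    rw [hint]; simp [modelLength_zero]
  rw [← hint2, ofReal_integral_eq_lintegral_ofReal hcont.integrableOn_Icc]
  · refine le_of_eq (setLIntegral_congr_fun measurableSet_Icc fun s hs => ?_)
    simp only
    rw [(hder s).hasDerivWithinAt.derivWithin (uniqueDiffOn_Icc zero_lt_one s hs),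
      spaceForm_speed (hd s hs), hn, ← mul_pow]
    congr 2
    simp [planeNorm]
  · filter_upwards [ae_restrict_mem measurableSet_Icc] with s hs
    have := hd s hs
    rw [mem_spaceFormDomain_iff, modelInterval, mem_ofPred_eq, hn, ← mul_pow] at this
    have h3 := planeNorm_nonneg z
    simp only [Pi.zero_apply]
    positivity

/-- By Cauchy–Schwarz, `modelLength` of the norm decreases along a path no faster than the speed of
the path. -/
theorem le_spaceFormDist {k : ℝ} {z : Fin 2 → ℝ} :
    ENNReal.ofReal (modelLength k (planeNorm z)) ≤ spaceFormDist k z := by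
  refine le_iInf₂ fun c ⟨hc, hmaps, hc0, hc1⟩ => ?_
  have hc0 : c 0 = z := hc0
  have hc1 : c 1 = 0 := hc1
  have hud := uniqueDiffOn_Icc (zero_lt_one (α := ℝ))
  have hcc := hc.continuousOn
  have hdc : ContinuousOn (derivWithin c (Icc 0 1)) (Icc 0 1) :=
    hc.continuousOn_derivWithin hud le_rfl
  have hnc : Continuous planeNorm := by unfold planeNorm; fun_prop
  set v : ℝ → ℝ := fun s => (1 + k / 4 * planeNorm (c s) ^ 2)⁻¹ *
    planeNorm (derivWithin c (Icc 0 1) s) with hv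
  have hpos : ∀ s ∈ Icc (0 : ℝ) 1, 0 < 1 + k / 4 * planeNorm (c s) ^ 2 := fun s hs =>
    mem_spaceFormDomain_iff.1 (hmaps hs)
  have hvc : ContinuousOn v (Icc 0 1) := by
    refine ContinuousOn.mul (ContinuousOn.inv₀ ?_ fun s hs => (hpos s hs).ne')
      (hnc.comp_continuousOn hdc)
    exact continuousOn_const.add (continuousOn_const.mul ((hnc.comp_continuousOn hcc).pow 2))
  have hv0 : ∀ s ∈ Icc (0 : ℝ) 1, 0 ≤ v s := fun s hs =>
    mul_nonneg (inv_nonneg.2 (hpos s hs).le) (planeNorm_nonneg _)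
  have hlen : pathLength (spaceFormMetric k) c = ENNReal.ofReal (∫ s in Icc (0 : ℝ) 1, v s) := by
    rw [ofReal_integral_eq_lintegral_ofReal hvc.integrableOn_Icc]
    · refine setLIntegral_congr_fun measurableSet_Icc fun s hs => ?_
      rw [spaceForm_speed (hmaps hs)]
    · filter_upwards [ae_restrict_mem measurableSet_Icc] with s hs using hv0 s hs
  rw [hlen]
  apply ENNReal.ofReal_le_ofReal
  -- The Euclidean norm is not differentiable at the origin, so the path is cut at its first arrival
  -- there; the rest only adds length.
  obtain ⟨τ, ⟨hτ, hτ0⟩, hleast⟩ : ∃ τ, IsLeast (Icc (0 : ℝ) 1 ∩ {s | planeNorm (c s) = 0}) τ := by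
    refine IsCompact.exists_isLeast ?_ ⟨1, by simp, by simp [hc1, planeNorm]⟩
    have := (hnc.comp_continuousOn hcc).preimage_isClosed_of_isClosed isClosed_Icc
      (isClosed_singleton (x := (0 : ℝ)))
    exact isCompact_Icc.of_isClosed_subset this inter_subset_left
  have hτ0 : planeNorm (c τ) = 0 := hτ0
  have hne : ∀ s ∈ Ioo 0 τ, 0 < planeNorm (c s) := fun s hs =>
    lt_of_le_of_ne (planeNorm_nonneg _) fun h =>
      absurd (hleast ⟨⟨hs.1.le, hs.2.le.trans hτ.2⟩, h.symm⟩) (not_le.2 hs.2)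
  have hsub : Icc 0 τ ⊆ Icc (0 : ℝ) 1 := Icc_subset_Icc_right hτ.2
  have hg : ContinuousOn (fun s => -modelLength k (planeNorm (c s))) (Icc 0 τ) := by
    intro s hs
    have h1 := (hasDerivAt_modelLength (mem_spaceFormDomain_iff.1
      (hmaps (hsub hs)))).continuousAt
    exact (h1.comp_continuousWithinAt
      (f := fun s => planeNorm (c s)) ((hnc.comp_continuousOn hcc).mono hsub s hs)).neg
  have hder : ∀ s ∈ Ioo 0 τ, HasDerivWithinAt (fun s => -modelLength k (planeNorm (c s)))
      (-((1 + k / 4 * planeNorm (c s) ^ 2)⁻¹ * ((2 * c s 0 * derivWithin c (Icc 0 1) s 0 +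
        2 * c s 1 * derivWithin c (Icc 0 1) s 1) / (2 * planeNorm (c s))))) (Ioi s) s := by
    intro s hs
    have hs1 : s ∈ Ioo (0 : ℝ) 1 := ⟨hs.1, hs.2.trans_le hτ.2⟩
    have hcd : HasDerivAt c (derivWithin c (Icc 0 1) s) s :=
      ((hc.differentiableOn one_ne_zero s (Ioo_subset_Icc_self hs1)).hasDerivWithinAt).hasDerivAt
        (Icc_mem_nhds hs1.1 hs1.2)
    have h0 := (hasDerivAt_pi.1 hcd 0).fun_pow 2
    have h1 := (hasDerivAt_pi.1 hcd 1).fun_pow 2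
    have hn0 : c s 0 ^ 2 + c s 1 ^ 2 ≠ 0 := by
      rw [← planeNorm_sq]; exact (pow_pos (hne s hs) 2).ne'
    have h2 := (h0.fun_add h1).sqrt hn0
    have h3 := (hasDerivAt_modelLength (mem_spaceFormDomain_iff.1
      (hmaps (hsub (Ioo_subset_Icc_self hs))))).comp s (h := fun s => planeNorm (c s)) h2
    refine (h3.neg.congr_deriv ?_).hasDerivWithinAt
    simp [planeNorm]
  have key := intervalIntegral.sub_le_integral_of_hasDeriv_right_of_le hτ.1 hg hder
    (hvc.mono hsub).integrableOn_Icc (fun s hs => by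
      have hs1 : s ∈ Icc (0 : ℝ) 1 := hsub (Ioo_subset_Icc_self hs)
      have hi := inv_pos.2 (hpos s hs1)
      rw [hv, ← mul_neg]
      refine mul_le_mul_of_nonneg_left ?_ hi.le
      have hn := hne s hs
      rw [← neg_div, div_le_iff₀ (by positivity)]
      have hd := planeNorm_sq (derivWithin c (Icc 0 1) s)
      have hd' := planeNorm_sq (c s)
      have hdn := planeNorm_nonneg (derivWithin c (Icc 0 1) s)
      generalize derivWithin c (Icc 0 1) s = w at *
      have : -(c s 0 * w 0 + c s 1 * w 1) ≤ planeNorm w * planeNorm (c s) := by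
        refine abs_le_of_sq_le_sq' ?_ (by positivity) |>.2
        rw [mul_pow, hd, hd']
        nlinarith [sq_nonneg (c s 0 * w 1 - c s 1 * w 0)]
      linarith)
  simp only [hτ0, hc0, modelLength_zero] at key
  rw [intervalIntegral.integral_of_le hτ.1, ← integral_Icc_eq_integral_Ioc] at key
  have hmono : ∫ s in Icc 0 τ, v s ≤ ∫ s in Icc (0 : ℝ) 1, v s := by
    refine setIntegral_mono_set hvc.integrableOn_Icc ?_ hsub.eventuallyLE
    filter_upwards [ae_restrict_mem measurableSet_Icc] with s hs using hv0 s hs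
  linarith

theorem spaceFormDist_eq {k : ℝ} {z : Fin 2 → ℝ} (hz : z ∈ spaceFormDomain k) :
    spaceFormDist k z = ENNReal.ofReal (modelLength k (planeNorm z)) :=
  le_antisymm (spaceFormDist_le hz) le_spaceFormDist

theorem planeNorm_base (p : Fin 3 → ℝ) : planeNorm (base p) = radius p := by
  simp [planeNorm, base, radius]

theorem modelLength_nonneg {k s : ℝ} (hs : s ∈ modelInterval k) (h0 : 0 ≤ s) :
    0 ≤ modelLength k s := by
  rw [← modelLength_zero k]
  exact (strictMonoOn_modelLength k).monotoneOn (zero_mem_modelInterval k) hs h0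

theorem mem_annularRegion {k a b : ℝ} {I : Set ℝ} (hb : 0 ≤ b) {p : Fin 3 → ℝ} :
    p ∈ annularRegion k a b I ↔ radius p ∈ modelInterval k ∧ a ≤ modelLength k (radius p) ∧
      modelLength k (radius p) ≤ b ∧ p 2 ∈ I := by
  have h1 : p ∈ annularRegion k a b I ↔ base p ∈ spaceFormDomain k ∧
    ENNReal.ofReal a ≤ spaceFormDist k (base p) ∧
    spaceFormDist k (base p) ≤ ENNReal.ofReal b ∧ p 2 ∈ I := Iff.rfl
  rw [h1, mem_spaceFormDomain_iff, planeNorm_base]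
  refine and_congr_right fun h => ?_
  rw [spaceFormDist_eq (mem_spaceFormDomain_iff.2 (planeNorm_base p ▸ h)), planeNorm_base,
    ENNReal.ofReal_le_ofReal_iff hb, ENNReal.ofReal_le_ofReal_iff (modelLength_nonneg h
      (radius_nonneg p))]

/-! ### The radial isometry onto the annular region of the model. -/

/-- The inverse of `modelLength`. -/
noncomputable def modelTan (sn cn : ℝ → ℝ) (s : ℝ) : ℝ := 2 * sn (s / 2) / cn (s / 2)

section

variable {k R : ℝ} {sn cn : ℝ → ℝ}

theorem IsModelPair.one_add_modelTan (h : IsModelPair k sn cn) {s : ℝ} (hs : 0 < cn (s / 2)) :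
    1 + k / 4 * modelTan sn cn s ^ 2 = (cn (s / 2) ^ 2)⁻¹ := by
  have := h.sq_add_sq (s / 2)
  unfold modelTan
  field_simp
  linarith

theorem IsModelPair.modelTan_mem (h : IsModelPair k sn cn) {s : ℝ} (hs : 0 < cn (s / 2)) :
    modelTan sn cn s ∈ modelInterval k := by
  rw [modelInterval, mem_ofPred_eq, h.one_add_modelTan hs]
  positivity

theorem IsModelPair.hasDerivAt_modelTan (h : IsModelPair k sn cn) {s : ℝ}
    (hs : 0 < cn (s / 2)) :
    HasDerivAt (modelTan sn cn) (cn (s / 2) ^ 2)⁻¹ s := by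
  have hh := (hasDerivAt_id' s).div_const 2
  have h1 := ((h.hasDerivAt_sn (s / 2)).comp s hh).const_mul 2
  have h2 := (h.hasDerivAt_cn (s / 2)).comp s hh
  refine (h1.fun_div h2 hs.ne').congr_deriv ?_
  have := h.sq_add_sq (s / 2)
  simp only [Function.comp]
  field_simp
  linarith

theorem IsModelPair.modelTan_zero (h : IsModelPair k sn cn) : modelTan sn cn 0 = 0 := by
  simp [modelTan, h.sn_zero]

/-- With $T$ for `modelTan`, $1+\tfrac k4T^2=\operatorname{cn}(s/2)^{-2}=T'$, so the composite has
derivative $1$ and vanishes at $0$. -/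
theorem IsModelPair.modelLength_modelTan (h : IsModelPair k sn cn)
    (hR : ∀ s ∈ Icc 0 R, 0 < cn (s / 2)) {s : ℝ} (hs : s ∈ Icc 0 R) :
    modelLength k (modelTan sn cn s) = s := by
  have hd : ∀ x ∈ Icc 0 R, HasDerivAt (fun s => modelLength k (modelTan sn cn s) - s) 0 x := by
    intro x hx
    refine (((hasDerivAt_modelLength (h.modelTan_mem (hR x hx))).comp x
      (h.hasDerivAt_modelTan (hR x hx))).sub (hasDerivAt_id' x)).congr_deriv ?_
    have := hR x hx
    rw [h.one_add_modelTan this]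
    field_simp
    simp
  have := constant_of_has_deriv_right_zero (fun x hx => (hd x hx).continuousAt.continuousWithinAt)
    (fun x hx => (hd x (Ico_subset_Icc_self hx)).hasDerivWithinAt) s hs
  simp only [h.modelTan_zero, modelLength_zero] at this
  linarith

theorem IsModelPair.modelTan_modelLength (h : IsModelPair k sn cn)
    (hR : ∀ s ∈ Icc 0 R, 0 < cn (s / 2)) {w : ℝ} (hw : w ∈ modelInterval k)
    (hs : modelLength k w ∈ Icc 0 R) :
    modelTan sn cn (modelLength k w) = w :=
  (strictMonoOn_modelLength k).injOn (h.modelTan_mem (hR _ hs)) hw (h.modelLength_modelTan hR hs)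

theorem IsModelPair.modelTan_pos (h : IsModelPair k sn cn)
    (hR : ∀ s ∈ Icc 0 R, 0 < cn (s / 2)) {s : ℝ} (hs : s ∈ Ioc 0 R) : 0 < modelTan sn cn s := by
  by_contra! hle
  have h1 := (strictMonoOn_modelLength k).monotoneOn
    (h.modelTan_mem (hR s ⟨hs.1.le, hs.2⟩)) (zero_mem_modelInterval k) hle
  rw [h.modelLength_modelTan hR ⟨hs.1.le, hs.2⟩, modelLength_zero] at h1
  linarith [hs.1]

end

/-- The map multiplying the distance to the axis `r` by `F r / r`. -/
noncomputable def radialMap (F : ℝ → ℝ) (p : Fin 3 → ℝ) : Fin 3 → ℝ :=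
  ![F (radius p) / radius p * p 0, F (radius p) / radius p * p 1, p 2]

theorem radius_radialMap {F : ℝ → ℝ} {p : Fin 3 → ℝ} (hp : 0 < radius p)
    (hF : 0 ≤ F (radius p)) : radius (radialMap F p) = F (radius p) := by
  have h := radius_sq p
  rw [radius, ← Real.sqrt_sq hF]
  congr 1
  simp only [radialMap, Matrix.cons_val]
  field_simp
  rw [h, radiusSq]

theorem radialMap_radialMap {F G : ℝ → ℝ} {p : Fin 3 → ℝ} (hp : 0 < radius p)
    (hF : 0 < F (radius p)) (hG : G (F (radius p)) = radius p) :
    radialMap G (radialMap F p) = p := by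
  have h := radius_radialMap hp hF.le
  conv_lhs => rw [radialMap, h, hG]
  ext i
  fin_cases i <;> simp [radialMap] <;> field_simp

theorem contDiffOn_radialMap {F : ℝ → ℝ} {N : Set (Fin 3 → ℝ)} (h0 : ∀ p ∈ N, 0 < radius p)
    (hF : ∀ p ∈ N, ContDiffAt ℝ ∞ F (radius p)) : ContDiffOn ℝ ∞ (radialMap F) N := by
  intro p hp
  apply ContDiffAt.contDiffWithinAt
  have h1 : ContDiffAt ℝ ∞ radius p := by
    refine ContDiffAt.sqrt (f := radiusSq) contDiff_radiusSq.contDiffAt ?_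
    rw [← radius_sq]
    exact (pow_pos (h0 p hp) 2).ne'
  have h2 : ContDiffAt ℝ ∞ (fun p => F (radius p) / radius p) p :=
    ((hF p hp).comp p h1).div h1 (h0 p hp).ne'
  rw [contDiffAt_pi]
  intro i
  fin_cases i <;> simp only [radialMap, Fin.zero_eta, Fin.mk_one, Fin.reduceFinMk,
    Matrix.cons_val] <;> fun_prop

/-- The annulus is not convex, but the half-space $\{\langle p,y\rangle\ge a|p|\}$ (horizontal
product) cuts from the outer cylinder a convex body with interior that contains `p` and, by
Cauchy–Schwarz, avoids the inner cylinder. -/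
theorem uniqueDiffWithinAt_annulus {a b : ℝ} (ha : 0 < a) (hab : a < b) {p : Fin 3 → ℝ}
    (hp : a ≤ radius p) (hpb : radius p ≤ b) :
    UniqueDiffWithinAt ℝ {p | a ≤ radius p ∧ radius p ≤ b} p := by
  have hr : 0 < radius p := ha.trans_le hp
  have hrq := radius_sq p
  rw [radiusSq] at hrq
  set K : Set (Fin 3 → ℝ) := {y | a * radius p ≤ p 0 * y 0 + p 1 * y 1} ∩ solidCylinder b
  have hK : K ⊆ {p | a ≤ radius p ∧ radius p ≤ b} := by
    rintro y ⟨h1, h2⟩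
    refine ⟨?_, h2⟩
    have h1 : a * radius p ≤ p 0 * y 0 + p 1 * y 1 := h1
    have h3 : p 0 * y 0 + p 1 * y 1 ≤ radius p * radius y := by
      refine abs_le_of_sq_le_sq' ?_ (mul_nonneg hr.le (radius_nonneg y)) |>.2
      rw [mul_pow, radius_sq y, radiusSq, hrq]
      nlinarith [sq_nonneg (p 0 * y 1 - p 1 * y 0)]
    nlinarith
  refine UniqueDiffWithinAt.mono (uniqueDiffWithinAt_convex (s := K) ?_ ?_ ?_) hK
  · refine Convex.inter ?_ (convex_solidCylinder b)
    intro x hx y hy s t hs ht hst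
    simp only [mem_ofPred_eq, Pi.add_apply, Pi.smul_apply, smul_eq_mul] at *
    have e : a * radius p = s * (a * radius p) + t * (a * radius p) := by
      rw [← add_mul, hst, one_mul]
    linarith [mul_le_mul_of_nonneg_left hx hs, mul_le_mul_of_nonneg_left hy ht]
  · set c := (a + b) / 2 / radius p with hc
    have hcr : c * radius p = (a + b) / 2 := by rw [hc]; field_simp
    have hc0 : 0 < c := by rw [hc]; have : 0 < b := ha.trans hab; positivity
    refine ⟨c • p, interior_maximal (t := {y | a * radius p < p 0 * y 0 + p 1 * y 1} ∩
      {y | radius y < b}) ?_ ?_ ⟨?_, ?_⟩⟩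
    · rintro y ⟨h1, h2⟩
      exact ⟨le_of_lt (α := ℝ) h1, le_of_lt (α := ℝ) h2⟩
    · exact (isOpen_lt continuous_const (by fun_prop)).inter
        (isOpen_lt continuous_radius continuous_const)
    · simp only [mem_ofPred_eq, Pi.smul_apply, smul_eq_mul]
      have : p 0 * (c * p 0) + p 1 * (c * p 1) = (c * radius p) * radius p := by
        linear_combination -c * hrq
      rw [this, hcr]
      nlinarith
    · have : radius (c • p) = c * radius p := by
        rw [radius, ← Real.sqrt_sq (mul_nonneg hc0.le hr.le)]
        congr 1
        simp only [Pi.smul_apply, smul_eq_mul]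
        linear_combination -c ^ 2 * hrq
      simp only [mem_ofPred_eq, this, hcr]
      linarith
  · refine subset_closure ⟨?_, hpb⟩
    simp only [mem_ofPred_eq]
    nlinarith

/-- The differential stretches by $F'$ radially and by $F/r$ angularly, while the conformal factor
at the image is $F'^{-2}$ by `hk`. The pullback is therefore $dr^2+(F/F')^2d\theta^2+dt^2$, and `hψ`
says that $F/F'=f$. -/
theorem pullback_radialMap {N : Set (Fin 3 → ℝ)} {F : ℝ → ℝ} {F' k : ℝ} {p : Fin 3 → ℝ}
    {U ψ : ℝ → ℝ} (hN : UniqueDiffWithinAt ℝ N p) (hr : 0 < radius p)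
    (hF : HasDerivAt F F' (radius p)) (hF0 : 0 ≤ F (radius p)) (hF' : F' ≠ 0)
    (hk : 1 + k / 4 * F (radius p) ^ 2 = F') (hU : U (radiusSq p) = 0)
    (hψ : F' * radius p * (1 - radiusSq p * ψ (radiusSq p)) = F (radius p)) :
    pullback N (radialMap F) (productMetric k) p = warpedMetric U ψ p := by
  have hrad := radius_radialMap hr hF0
  have hq : radius p ^ 2 = p 0 ^ 2 + p 1 ^ 2 := radius_sq p
  have hq' : radiusSq p = p 0 ^ 2 + p 1 ^ 2 := rfl
  set τ := F (radius p) / radius p with hτ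
  -- The horizontal Jacobian is $\tau\,\delta_{ij}+\sigma\,x_ix_j$, where $\sigma r^2=F'-\tau$.
  set σ := (F' * radius p - F (radius p)) / radius p ^ 3 with hσ
  have hP := HasPartials.comp (hF.fun_div (hasDerivAt_id' (radius p)) hr.ne')
    (hasPartials_radius (S := N) hr)
  have h0 := hP.mul (HasPartials.coord (S := N) 0)
  have h1 := hP.mul (HasPartials.coord (S := N) 1)
  have h2 := HasPartials.coord (S := N) (p := p) 2
  have hJ : jacobian N (radialMap F) p = !![τ + σ * p 0 ^ 2, σ * (p 0 * p 1), 0;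
      σ * (p 0 * p 1), τ + σ * p 1 ^ 2, 0; 0, 0, 1] := by
    ext a i
    simp only [jacobian, Matrix.of_apply]
    fin_cases a
    · simp only [Fin.zero_eta]
      rw [show (fun q => radialMap F q 0) = fun q => F (radius q) / radius q * q 0 from rfl,
        h0.pd_eq hN]
      fin_cases i <;> simp [hτ, hσ, hc] <;> field_simp
    · simp only [Fin.mk_one]
      rw [show (fun q => radialMap F q 1) = fun q => F (radius q) / radius q * q 1 from rfl,
        h1.pd_eq hN]
      fin_cases i <;> simp [hτ, hσ, hc] <;> field_simp
    · simp only [Fin.reduceFinMk]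
      rw [show (fun q => radialMap F q 2) = fun q => q 2 from rfl, h2.pd_eq hN]
      fin_cases i <;> simp
  have hfac : spaceFormFactor k (base (radialMap F p)) = (F' ^ 2)⁻¹ := by
    rw [spaceFormFactor, ← planeNorm_sq, planeNorm_base, hrad, hk]
  have hτF : τ * radius p = F (radius p) := by rw [hτ]; field_simp
  have hσF : σ * radius p ^ 2 = F' - τ := by rw [hσ, hτ]; field_simp
  have e1 : (F' ^ 2)⁻¹ * τ ^ 2 = (1 - radiusSq p * ψ (radiusSq p)) ^ 2 := by
    rw [hτ, ← hψ]; field_simp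
  have e2 : (F' ^ 2)⁻¹ * (2 * τ * σ + σ ^ 2 * radiusSq p) =
      2 * ψ (radiusSq p) - radiusSq p * ψ (radiusSq p) ^ 2 := by
    have h3 : radiusSq p ≠ 0 := by rw [← radius_sq]; positivity
    apply mul_left_cancel₀ h3
    rw [← radius_sq] at e1 ⊢
    have : radius p ^ 2 * ((F' ^ 2)⁻¹ * (2 * τ * σ + σ ^ 2 * radius p ^ 2)) =
        (F' ^ 2)⁻¹ * (2 * τ * (σ * radius p ^ 2) + (σ * radius p ^ 2) ^ 2) := by ring
    rw [this, hσF]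
    have : (F' ^ 2)⁻¹ * F' ^ 2 = 1 := inv_mul_cancel₀ (pow_ne_zero 2 hF')
    linear_combination this - e1
  rw [pullback, hJ, productMetric, hfac, warpedMetric, radialMetric, hU]
  simp only [mul_zero, Real.exp_zero, one_mul]
  rw [← e1, ← e2, hq']
  ext i j
  fin_cases i <;> fin_cases j <;>
    simp [Matrix.mul_apply, Fin.sum_univ_three, Matrix.diagonal] <;> ring

/-- The radial map taking geodesic radius to conformal radius; `modelLength` gives its inverse. Here
$F/F'=2\operatorname{sn}(r/2)\operatorname{cn}(r/2)=\operatorname{sn}(r)$. -/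
theorem IsModelPair.isRiemannianIsometry {k : ℝ} {sn cn U ψ : ℝ → ℝ} (h : IsModelPair k sn cn)
    {a b : ℝ} (ha : 0 < a) (hab : a < b) (hR : ∀ s ∈ Icc 0 b, 0 < cn (s / 2))
    (hU : ∀ q, a ^ 2 ≤ q → U q = 0)
    (hψ : ∀ r, a ≤ r → r ≤ b → r * (1 - r ^ 2 * ψ (r ^ 2)) = sn r) :
    IsRiemannianIsometry {p | a ≤ radius p ∧ radius p ≤ b} (warpedMetric U ψ)
      (annularRegion k a b univ) (productMetric k) (radialMap (modelTan sn cn)) ∧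
    radialMap (modelTan sn cn) '' lateralBoundary b = annularRegion k b b univ := by
  have hb : 0 < b := ha.trans hab
  have hsm : ∀ s ∈ Icc 0 b, ContDiffAt ℝ ∞ (modelTan sn cn) s := by
    intro s hs
    have := h.contDiff_sn
    have := h.contDiff_cn
    refine ContDiffAt.div (by fun_prop) ?_ (hR s hs).ne'
    fun_prop
  have hmaps : ∀ p, a ≤ radius p → radius p ≤ b →
      radius (radialMap (modelTan sn cn) p) = modelTan sn cn (radius p) ∧
      modelLength k (modelTan sn cn (radius p)) = radius p ∧
      0 < modelTan sn cn (radius p) ∧ modelTan sn cn (radius p) ∈ modelInterval k := by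
    intro p h1 h2
    have h0 := ha.trans_le h1
    have hpos := h.modelTan_pos hR ⟨h0, h2⟩
    exact ⟨radius_radialMap h0 hpos.le, h.modelLength_modelTan hR ⟨h0.le, h2⟩, hpos,
      h.modelTan_mem (hR _ ⟨h0.le, h2⟩)⟩
  have hA : ∀ p, p ∈ annularRegion k a b univ → 0 < radius p ∧ radius p ∈ modelInterval k ∧
      a ≤ modelLength k (radius p) ∧ modelLength k (radius p) ≤ b := by
    intro p hp
    rw [mem_annularRegion hb.le] at hp
    refine ⟨lt_of_le_of_ne (radius_nonneg p) fun h0 => ?_, hp.1, hp.2.1, hp.2.2.1⟩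
    have := hp.2.1
    rw [← h0, modelLength_zero] at this
    linarith
  have hinv : ∀ p, p ∈ annularRegion k a b univ →
      radialMap (modelTan sn cn) (radialMap (modelLength k) p) = p ∧
      radius (radialMap (modelLength k) p) = modelLength k (radius p) := by
    intro p hp
    obtain ⟨h0, h1, h2, h3⟩ := hA p hp
    exact ⟨radialMap_radialMap h0 (ha.trans_le h2) (h.modelTan_modelLength hR h1
      ⟨ha.le.trans h2, h3⟩), radius_radialMap h0 (ha.le.trans h2)⟩
  have hinv' : ∀ p, a ≤ radius p → radius p ≤ b →
      radialMap (modelLength k) (radialMap (modelTan sn cn) p) = p := by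
    intro p h1 h2
    obtain ⟨-, h3, h4, -⟩ := hmaps p h1 h2
    exact radialMap_radialMap (ha.trans_le h1) h4 h3
  have hInvOn : InvOn (radialMap (modelLength k)) (radialMap (modelTan sn cn))
      {p | a ≤ radius p ∧ radius p ≤ b} (annularRegion k a b univ) :=
    ⟨fun p hp => hinv' p hp.1 hp.2, fun p hp => (hinv p hp).1⟩
  refine ⟨⟨?_, hInvOn.bijOn ?_ ?_, ⟨radialMap (modelLength k), ?_, hInvOn⟩, ?_⟩, ?_⟩
  · exact contDiffOn_radialMap (fun p hp => ha.trans_le hp.1)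
      fun p hp => hsm _ ⟨radius_nonneg p, hp.2⟩
  · intro p hp
    obtain ⟨h1, h2, h3, h4⟩ := hmaps p hp.1 hp.2
    rw [mem_annularRegion hb.le, h1, h2]
    exact ⟨h4, hp.1, hp.2, trivial⟩
  · intro p hp
    have := hA p hp
    show _ ∧ _
    rw [(hinv p hp).2]
    exact ⟨this.2.2.1, this.2.2.2⟩
  · exact contDiffOn_radialMap (fun p hp => (hA p hp).1) fun p hp =>
      (contDiffOn_modelLength k).contDiffAt ((isOpen_modelInterval k).mem_nhds (hA p hp).2.1)
  · intro p hp
    have h0 := ha.trans_le hp.1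
    have hc := hR _ ⟨h0.le, hp.2⟩
    obtain ⟨h1, h2, h3, h4⟩ := hmaps p hp.1 hp.2
    refine pullback_radialMap (uniqueDiffWithinAt_annulus ha hab hp.1 hp.2) h0
      (h.hasDerivAt_modelTan hc) h3.le (by positivity) (h.one_add_modelTan hc)
      (hU _ (by rw [← radius_sq]; gcongr; exact hp.1)) ?_
    have h5 := hψ _ hp.1 hp.2
    have h6 := h.sn_two_mul (radius p / 2)
    rw [mul_div_cancel₀ _ two_ne_zero] at h6
    rw [radius_sq] at h5
    rw [mul_assoc, h5, h6, modelTan]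
    field_simp
  · ext p
    rw [mem_annularRegion hb.le]
    constructor
    · rintro ⟨y, hy, rfl⟩
      have hy : radius y = b := hy
      obtain ⟨h1, h2, h3, h4⟩ := hmaps y (by linarith) hy.le
      rw [h1, h2]
      exact ⟨h4, hy.ge, hy.le, trivial⟩
    · rintro ⟨h1, h2, h3, -⟩
      have hp : p ∈ annularRegion k a b univ := by
        rw [mem_annularRegion hb.le]
        exact ⟨h1, by linarith, h3, trivial⟩
      refine ⟨radialMap (modelLength k) p, ?_, (hinv p hp).1⟩
      show radius _ = b
      rw [(hinv p hp).2]
      exact le_antisymm h3 h2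

/-! ### Volume and distance estimates. -/

/-- The box `[-c, c]² × [0, 1]`. -/
def centeredBox (c : ℝ) : Set (Fin 3 → ℝ) := Icc ![-c, -c, 0] ![c, c, 1]

theorem mem_centeredBox {c : ℝ} {p : Fin 3 → ℝ} :
    p ∈ centeredBox c ↔ |p 0| ≤ c ∧ |p 1| ≤ c ∧ p 2 ∈ Icc 0 1 := by
  simp only [centeredBox, mem_Icc, Pi.le_def, Fin.forall_fin_succ, abs_le]
  simp
  tauto

theorem volume_centeredBox {c : ℝ} (hc : 0 ≤ c) :
    volume (centeredBox c) = ENNReal.ofReal (4 * c ^ 2) := by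
  rw [centeredBox, Real.volume_Icc_pi, Fin.prod_univ_three]
  simp only [Matrix.cons_val]
  rw [← ENNReal.ofReal_mul (by linarith), ← ENNReal.ofReal_mul (by nlinarith)]
  congr 1
  ring

theorem mem_centeredBox_of_radius_le {c : ℝ} {p : Fin 3 → ℝ} (h : radius p ≤ c)
    (h2 : p 2 ∈ Icc (0 : ℝ) 1) : p ∈ centeredBox c := by
  have hc : 0 ≤ c := (radius_nonneg p).trans h
  have hq := radius_sq p
  rw [radiusSq] at hq
  have h3 : radius p ^ 2 ≤ c ^ 2 := pow_le_pow_left₀ (radius_nonneg p) h 2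
  rw [mem_centeredBox]
  exact ⟨abs_le_of_sq_le_sq (by nlinarith [sq_nonneg (p 1)]) hc,
    abs_le_of_sq_le_sq (by nlinarith [sq_nonneg (p 0)]) hc, h2⟩

theorem measurableSet_centeredBox (c : ℝ) : MeasurableSet (centeredBox c) := measurableSet_Icc

/-- The hypothesis keeps $1+\tfrac k4t^2$ above $1-\tfrac1{20}$, whence the constant $20/19$. -/
theorem modelLength_le {k w : ℝ} (hw : 0 ≤ w) (hk : |k| * w ^ 2 ≤ 1 / 5) :
    modelLength k w ≤ 20 / 19 * w := by
  have hpos : ∀ t ∈ Icc 0 w, 19 / 20 ≤ 1 + k / 4 * t ^ 2 := by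
    intro t ht
    have h1 : t ^ 2 ≤ w ^ 2 := pow_le_pow_left₀ ht.1 ht.2 2
    nlinarith [neg_abs_le k, abs_nonneg k, sq_nonneg t]
  have hi : IntervalIntegrable (fun t : ℝ => (1 + k / 4 * t ^ 2)⁻¹) volume 0 w := by
    refine ContinuousOn.intervalIntegrable_of_Icc hw (ContinuousOn.inv₀ (by fun_prop) fun t ht => ?_)
    linarith [hpos t ht]
  have := intervalIntegral.integral_mono_on hw hi
    (intervalIntegrable_const (c := (20 / 19 : ℝ))) fun t ht => by
      rw [inv_le_comm₀ (by linarith [hpos t ht]) (by norm_num)]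
      linarith [hpos t ht]
  rw [modelLength]
  refine this.trans (le_of_eq ?_)
  simp
  ring

/-- The box of half-width $r$ fits in the geodesic cylinder of radius $2r$: its corners have
Euclidean radius $\sqrt2\,r\le\tfrac32r$, and $\tfrac32\cdot\tfrac{20}{19}<2$. The volume density
there is at least $(20/21)^2>\tfrac12$. -/
theorem le_riemannianVolume_annularRegion {k r : ℝ} (hr : 0 < r) (hk : |k| * r ^ 2 ≤ 1 / 10) :
    ENNReal.ofReal (2 * r ^ 2) ≤
      riemannianVolume (productMetric k) (annularRegion k 0 (2 * r) (Icc 0 1)) := by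
  have hbox : ∀ p ∈ centeredBox r, |k| * radius p ^ 2 ≤ 1 / 5 ∧ radius p ^ 2 ≤ 2 * r ^ 2 := by
    intro p hp
    rw [mem_centeredBox] at hp
    have h0 : p 0 ^ 2 ≤ r ^ 2 := sq_le_sq' (abs_le.1 hp.1).1 (abs_le.1 hp.1).2
    have h1 : p 1 ^ 2 ≤ r ^ 2 := sq_le_sq' (abs_le.1 hp.2.1).1 (abs_le.1 hp.2.1).2
    rw [radius_sq, radiusSq]
    have h2 : p 0 ^ 2 + p 1 ^ 2 ≤ 2 * r ^ 2 := by linarith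
    refine ⟨?_, h2⟩
    nlinarith [mul_le_mul_of_nonneg_left h2 (abs_nonneg k)]
  have hsub : centeredBox r ⊆ annularRegion k 0 (2 * r) (Icc 0 1) := by
    intro p hp
    obtain ⟨h1, h2⟩ := hbox p hp
    rw [mem_annularRegion (by positivity)]
    have hm : radius p ∈ modelInterval k := by
      simp only [modelInterval, mem_ofPred_eq]
      nlinarith [neg_abs_le k, sq_nonneg (radius p)]
    refine ⟨hm, modelLength_nonneg hm (radius_nonneg p),
      (modelLength_le (radius_nonneg p) h1).trans ?_, (mem_centeredBox.1 hp).2.2⟩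
    have : radius p ≤ 3 / 2 * r := abs_le_of_sq_le_sq' (by nlinarith) (by positivity) |>.2
    linarith
  refine le_trans ?_ (lintegral_mono_set hsub)
  calc ENNReal.ofReal (2 * r ^ 2) = ENNReal.ofReal (1 / 2) * volume (centeredBox r) := by
        rw [volume_centeredBox hr.le, ← ENNReal.ofReal_mul (by norm_num)]
        congr 1
        ring
    _ = ∫⁻ _ in centeredBox r, ENNReal.ofReal (1 / 2) := by rw [setLIntegral_const]
    _ ≤ _ := by
        refine setLIntegral_mono' (measurableSet_centeredBox r) fun p hp => ?_
        apply ENNReal.ofReal_le_ofReal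
        have h1 := (hbox p hp).1
        have hdet : (productMetric k p).det = spaceFormFactor k (base p) ^ 2 := by
          rw [productMetric, Matrix.det_diagonal, Fin.prod_univ_three]
          simp
          ring
        have hf : spaceFormFactor k (base p) = ((1 + k / 4 * radius p ^ 2) ^ 2)⁻¹ := by
          rw [spaceFormFactor, ← planeNorm_sq, planeNorm_base]
        have hle : 1 + k / 4 * radius p ^ 2 ≤ 21 / 20 := by
          nlinarith [le_abs_self k, sq_nonneg (radius p)]
        have hge : 19 / 20 ≤ 1 + k / 4 * radius p ^ 2 := by
          nlinarith [neg_abs_le k, sq_nonneg (radius p)]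
        rw [hdet, hf, Real.sqrt_sq (by positivity), le_inv_comm₀ (by norm_num) (by positivity)]
        nlinarith

/-- The density $e^{-U}|\varphi|$ is at most $2$ outside radius $b$ and at most $2M$ inside; both
regions are enclosed in boxes. -/
theorem riemannianVolume_warpedMetric_le {U ψ : ℝ → ℝ} {ρ b M : ℝ} (hρ : 0 ≤ ρ) (hb : 0 ≤ b)
    (hM0 : 0 ≤ M) (hM : ∀ q, 0 ≤ q → Real.exp (-U q) ≤ M) (hU : ∀ q, b ^ 2 ≤ q → U q = 0)
    (hφ : ∀ q, 0 ≤ q → q ≤ ρ ^ 2 → |1 - q * ψ q| ≤ 2) :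
    riemannianVolume (warpedMetric U ψ) {p ∈ solidCylinder ρ | p 2 ∈ Icc 0 1} ≤
      ENNReal.ofReal (8 * ρ ^ 2 + 8 * M * b ^ 2) := by
  have hsub : {p ∈ solidCylinder ρ | p 2 ∈ Icc 0 1} ⊆ centeredBox ρ := fun p hp =>
    mem_centeredBox_of_radius_le hp.1 hp.2
  have hmeas : MeasurableSet {p ∈ solidCylinder ρ | p 2 ∈ Icc 0 1} :=
    (measurableSet_le continuous_radius.measurable measurable_const).inter
      (measurableSet_Icc.preimage (measurable_pi_apply 2))
  unfold riemannianVolume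
  calc ∫⁻ p in {p ∈ solidCylinder ρ | p 2 ∈ Icc 0 1}, ENNReal.ofReal √(warpedMetric U ψ p).det
      ≤ ∫⁻ p in {p ∈ solidCylinder ρ | p 2 ∈ Icc 0 1}, (ENNReal.ofReal 2 +
          (centeredBox b).indicator (fun _ => ENNReal.ofReal (2 * M)) p) := by
        refine setLIntegral_mono' hmeas fun p hp => ?_
        have hq : radiusSq p ≤ ρ ^ 2 := by
          rw [← radius_sq]; exact pow_le_pow_left₀ (radius_nonneg p) hp.1 2
        have hD := hφ _ (radiusSq_nonneg p) hq
        rw [det_warpedMetric]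
        by_cases h : b ^ 2 ≤ radiusSq p
        · rw [hU _ h]
          refine le_trans (ENNReal.ofReal_le_ofReal ?_) le_self_add
          simpa using hD
        · have hp' : p ∈ centeredBox b := by
            refine mem_centeredBox_of_radius_le ?_ hp.2
            rw [← radius_sq] at h
            exact (lt_of_pow_lt_pow_left₀ 2 hb (not_le.1 h)).le
          rw [indicator_of_mem hp']
          refine le_trans (ENNReal.ofReal_le_ofReal ?_) le_add_self
          rw [mul_comm 2 M]
          exact mul_le_mul (hM _ (radiusSq_nonneg p)) hD (abs_nonneg _) hM0
    _ ≤ ∫⁻ p in centeredBox ρ, (ENNReal.ofReal 2 +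
          (centeredBox b).indicator (fun _ => ENNReal.ofReal (2 * M)) p) := lintegral_mono_set hsub
    _ = ENNReal.ofReal 2 * volume (centeredBox ρ) + ∫⁻ p in centeredBox ρ,
          (centeredBox b).indicator (fun _ => ENNReal.ofReal (2 * M)) p := by
        rw [lintegral_add_left measurable_const, setLIntegral_const]
    _ ≤ ENNReal.ofReal 2 * volume (centeredBox ρ) +
          ENNReal.ofReal (2 * M) * volume (centeredBox b) := by
        gcongr
        refine (setLIntegral_le_lintegral _ _).trans ?_
        rw [lintegral_indicator_const (measurableSet_centeredBox b)]
    _ = ENNReal.ofReal (8 * ρ ^ 2 + 8 * M * b ^ 2) := by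
        rw [volume_centeredBox hρ, volume_centeredBox hb, ← ENNReal.ofReal_mul (by norm_num),
          ← ENNReal.ofReal_mul (by positivity), ← ENNReal.ofReal_add (by positivity)
          (by positivity)]
        congr 1
        ring

/-- A horizontal radial segment has speed $\rho e^{-U}$, so only its part inside radius $b$ is
lengthened, and by a factor at most $M$. -/
theorem setDist_warpedMetric_le {U ψ : ℝ → ℝ} {ρ b M : ℝ} (hρ : 0 < ρ) (hb : 0 ≤ b)
    (hM0 : 0 ≤ M) (hM : ∀ q, 0 ≤ q → Real.exp (-U q) ≤ M) (hU : ∀ q, b ^ 2 ≤ q → U q = 0) :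
    setDist (solidCylinder ρ) (warpedMetric U ψ) axis (lateralBoundary ρ) ≤
      ENNReal.ofReal (ρ + M * b) := by
  set c : ℝ → Fin 3 → ℝ := fun s => s • ![ρ, 0, 0] with hc
  have hrad : ∀ s, 0 ≤ s → radius (c s) = s * ρ := by
    intro s hs
    have : 0 ≤ s * ρ := by positivity
    rw [radius, ← Real.sqrt_sq this]
    simp [hc]
  have hder : ∀ s, HasDerivAt c ![ρ, 0, 0] s := by
    intro s
    have := (hasDerivAt_id' s).smul_const (![ρ, 0, 0] : Fin 3 → ℝ)
    rwa [one_smul] at this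
  refine (iInf₂_le c ⟨?_, ?_, ?_, ?_⟩).trans ?_
  rotate_left
  · exact (contDiff_id.smul contDiff_const).contDiffOn
  · intro s hs
    show radius (c s) ≤ ρ
    rw [hrad s hs.1]
    nlinarith [hs.2]
  · show radius (c 0) = 0
    rw [hrad 0 le_rfl, zero_mul]
  · show radius (c 1) = ρ
    rw [hrad 1 zero_le_one, one_mul]
  unfold pathLength
  calc _ ≤ ∫⁻ s in Icc (0 : ℝ) 1, (ENNReal.ofReal ρ +
        (Icc 0 (b / ρ)).indicator (fun _ => ENNReal.ofReal (ρ * M)) s) := by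
        refine setLIntegral_mono' measurableSet_Icc fun s hs => ?_
        rw [(hder s).hasDerivWithinAt.derivWithin (uniqueDiffOn_Icc zero_lt_one s hs)]
        have hq : radiusSq (c s) = (s * ρ) ^ 2 := by rw [← radius_sq, hrad s hs.1]
        have hspeed : √((![ρ, 0, 0] : Fin 3 → ℝ) ⬝ᵥ (warpedMetric U ψ (c s) *ᵥ ![ρ, 0, 0])) =
            ρ * Real.exp (-U ((s * ρ) ^ 2)) := by
          have h2 : 0 ≤ ρ * Real.exp (-U ((s * ρ) ^ 2)) := by positivity
          rw [← Real.sqrt_sq h2]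
          congr 1
          have h3 : Real.exp (-U ((s * ρ) ^ 2)) ^ 2 = Real.exp (-2 * U ((s * ρ) ^ 2)) := by
            rw [← Real.exp_nat_mul]; push_cast; ring_nf
          rw [mul_pow, h3]
          simp only [warpedMetric, radialMetric, hq]
          simp [hc, Matrix.mulVec, dotProduct, Fin.sum_univ_three]
          ring
        rw [hspeed]
        by_cases h : b ^ 2 ≤ (s * ρ) ^ 2
        · rw [hU _ h]
          simp
        · have hs' : s ∈ Icc 0 (b / ρ) := by
            refine ⟨hs.1, ?_⟩
            rw [le_div_iff₀ hρ]
            exact (lt_of_pow_lt_pow_left₀ 2 hb (not_le.1 h)).le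
          rw [indicator_of_mem hs']
          refine le_trans (ENNReal.ofReal_le_ofReal ?_) le_add_self
          gcongr
          exact hM _ (sq_nonneg _)
    _ ≤ ENNReal.ofReal ρ + ENNReal.ofReal (ρ * M) * volume (Icc 0 (b / ρ)) := by
        rw [lintegral_add_left measurable_const, setLIntegral_const, Real.volume_Icc]
        gcongr
        · simp
        · refine (setLIntegral_le_lintegral _ _).trans ?_
          rw [lintegral_indicator_const measurableSet_Icc, Real.volume_Icc]
    _ = ENNReal.ofReal (ρ + M * b) := by
        rw [Real.volume_Icc, ← ENNReal.ofReal_mul (by positivity), ← ENNReal.ofReal_add hρ.le]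
        · congr 1
          field_simp
          ring
        · have : 0 ≤ b / ρ := by positivity
          rw [sub_zero]
          positivity

/-! ### The smooth transition, and division by $q$ at the axis. -/

theorem exists_bound_of_continuous_of_eq_zero {f : ℝ → ℝ} (hf : Continuous f)
    (h : ∀ x, x ∉ Icc (0 : ℝ) 1 → f x = 0) : ∃ C, ∀ x, |f x| ≤ C := by
  obtain ⟨C, hC⟩ := isCompact_Icc.exists_bound_of_continuousOn (s := Icc (0 : ℝ) 1) hf.continuousOn
  refine ⟨max C 0, fun x => ?_⟩
  by_cases hx : x ∈ Icc (0 : ℝ) 1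
  · exact (hC x hx).trans (le_max_left _ _)
  · simp [h x hx]

theorem deriv_eq_zero_of_eq_const_off_Icc {f : ℝ → ℝ} {c d : ℝ} (h0 : ∀ x < 0, f x = c)
    (h1 : ∀ x > 1, f x = d) {x : ℝ} (hx : x ∉ Icc (0 : ℝ) 1) : deriv f x = 0 := by
  rw [mem_Icc, not_and_or, not_le, not_le] at hx
  rcases hx with hx | hx
  · have : f =ᶠ[𝓝 x] fun _ => c := by filter_upwards [gt_mem_nhds hx] with y hy using h0 y hy
    rw [this.deriv_eq, deriv_const]
  · have : f =ᶠ[𝓝 x] fun _ => d := by filter_upwards [lt_mem_nhds hx] with y hy using h1 y hy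
    rw [this.deriv_eq, deriv_const]

theorem exists_bound_deriv_smoothTransition : ∃ C, 1 ≤ C ∧
    ∀ x, |deriv Real.smoothTransition x| ≤ C ∧ |deriv (deriv Real.smoothTransition) x| ≤ C := by
  have hs : ContDiff ℝ ∞ Real.smoothTransition := Real.smoothTransition.contDiff
  have hs1 := (contDiff_infty_iff_deriv.1 hs).2
  have hs2 := (contDiff_infty_iff_deriv.1 hs1).2
  have h1 : ∀ x, x ∉ Icc (0 : ℝ) 1 → deriv Real.smoothTransition x = 0 := fun x =>
    deriv_eq_zero_of_eq_const_off_Icc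
      (fun x hx => Real.smoothTransition.zero_of_nonpos hx.le)
      (fun x hx => Real.smoothTransition.one_of_one_le (le_of_lt hx))
  have h2 : ∀ x, x ∉ Icc (0 : ℝ) 1 → deriv (deriv Real.smoothTransition) x = 0 := fun x =>
    deriv_eq_zero_of_eq_const_off_Icc (c := 0) (d := 0)
      (fun x hx => h1 x fun h => absurd h.1 (not_le.2 hx))
      (fun x hx => h1 x fun h => absurd h.2 (not_le.2 hx))
  obtain ⟨A, hA⟩ := exists_bound_of_continuous_of_eq_zero hs1.continuous h1
  obtain ⟨B, hB⟩ := exists_bound_of_continuous_of_eq_zero hs2.continuous h2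
  exact ⟨max 1 (max A B), le_max_left _ _, fun x =>
    ⟨(hA x).trans ((le_max_left _ _).trans (le_max_right _ _)),
    (hB x).trans ((le_max_right _ _).trans (le_max_right _ _))⟩⟩

/-- Such points are global minima. This includes the endpoint $0$, so vanishing holds on the closed
range where the potential is off. -/
theorem deriv_smoothTransition_of_nonpos {x : ℝ} (hx : x ≤ 0) :
    deriv Real.smoothTransition x = 0 := by
  apply IsLocalMin.deriv_eq_zero
  filter_upwards with y
  rw [Real.smoothTransition.zero_of_nonpos hx]
  exact Real.smoothTransition.nonneg y

/-- Smoothness of the metric across the axis requires $(1-\varphi^2)/q$ to be smooth at $q=0$.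
Analyticity of $\varphi$ there makes the difference quotient a power series; elsewhere it is an
ordinary quotient. -/
theorem exists_eq_one_sub_mul {φ : ℝ → ℝ} (h : ∀ q, 0 ≤ q → ContDiffAt ℝ ∞ φ q)
    (h0 : AnalyticAt ℝ φ 0) (h1 : φ 0 = 1) :
    ∃ ψ : ℝ → ℝ, (∀ q, 0 ≤ q → ContDiffAt ℝ ∞ ψ q) ∧ ∀ q, φ q = 1 - q * ψ q := by
  refine ⟨fun q => -dslope φ 0 q, fun q hq => ?_, fun q => ?_⟩
  · rcases hq.eq_or_lt with rfl | hq
    · obtain ⟨p, hp⟩ := h0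
      exact hp.has_fpower_series_dslope_fslope.analyticAt.contDiffAt.neg
    · have : dslope φ 0 =ᶠ[𝓝 q] fun q => q⁻¹ * (φ q - 1) := by
        filter_upwards [lt_mem_nhds hq] with y hy
        rw [dslope_of_ne _ hy.ne', slope_def_field, h1]
        ring
      refine (ContDiffAt.congr_of_eventuallyEq ?_ this).neg
      exact (contDiffAt_id.inv hq.ne').mul ((h q hq.le).sub contDiffAt_const)
  · have := sub_smul_dslope φ 0 q
    rw [h1, smul_eq_mul, sub_zero] at this
    linarith

theorem deriv_one_sub_mul {φ ψ : ℝ → ℝ} (h : ∀ q, 0 ≤ q → ContDiffAt ℝ ∞ ψ q)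
    (hφ : ∀ q, φ q = 1 - q * ψ q) {q : ℝ} (hq : 0 ≤ q) :
    deriv φ q = -(ψ q + q * deriv ψ q) ∧
      deriv (deriv φ) q = -(2 * deriv ψ q + q * deriv (deriv ψ) q) := by
  have hφ' : φ = fun q => 1 - q * ψ q := funext hφ
  have h1 : ∀ q, DifferentiableAt ℝ ψ q → deriv φ q = -(ψ q + q * deriv ψ q) := by
    intro q hq
    rw [hφ', (((hasDerivAt_id' q).fun_mul hq.hasDerivAt).const_sub 1).deriv]
    ring
  have hd := (h q hq).differentiableAt (by simp)
  refine ⟨h1 q hd, ?_⟩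
  have hev : deriv φ =ᶠ[𝓝 q] fun q => -(ψ q + q * deriv ψ q) := by
    have : ∀ᶠ y in 𝓝 q, ContDiffAt ℝ 1 ψ y :=
      ((h q hq).of_le (by exact_mod_cast le_top)).eventually (by simp)
    filter_upwards [this] with y hy using h1 y (hy.differentiableAt (by simp))
  have hd2 := ((h q hq).deriv_infty.differentiableAt (by simp)).hasDerivAt
  rw [hev.deriv_eq, ((hd.hasDerivAt.fun_add ((hasDerivAt_id' q).fun_mul hd2)).fun_neg).deriv]
  ring

/-! ### Taylor estimates for $\operatorname{sn}(r)/r$ in the variable $r^2$. -/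

theorem abs_le_pow_succ_of_abs_deriv_le {g g' : ℝ → ℝ} {β R : ℝ} (n : ℕ) (hβ : 0 ≤ β)
    (hg0 : g 0 = 0) (hg : ∀ x, HasDerivAt g (g' x) x) (h : ∀ x ∈ Icc 0 R, |g' x| ≤ β * x ^ n)
    {x : ℝ} (hx : x ∈ Icc 0 R) : |g x| ≤ β * x ^ (n + 1) := by
  have := norm_image_sub_le_of_norm_deriv_le_segment' (f := g) (f' := g') (C := β * x ^ n)
    (a := 0) (b := x) (fun y _ => (hg y).hasDerivWithinAt) (fun y hy => by
      refine (h y ⟨hy.1, hy.2.le.trans hx.2⟩).trans ?_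
      have := pow_le_pow_left₀ hy.1 hy.2.le n
      gcongr) x ⟨hx.1, le_rfl⟩
  rw [hg0, sub_zero, sub_zero, Real.norm_eq_abs] at this
  rw [pow_succ, ← mul_assoc]
  exact this

/-- Three integrations of $|k(\operatorname{cn}-1)|\le\beta$, using
$\operatorname{sn}''=-k\operatorname{sn}$; the factorial gain is not needed. -/
theorem IsModelPair.abs_sub_taylor_le {k β R : ℝ} {sn cn : ℝ → ℝ} (h : IsModelPair k sn cn)
    (hβ : 0 ≤ β) (hR : ∀ x ∈ Icc 0 R, |k * (cn x - 1)| ≤ β) {x : ℝ} (hx : x ∈ Icc 0 R) :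
    |sn x - x + k / 6 * x ^ 3| ≤ β * x ^ 3 ∧ |cn x - 1 + k / 2 * x ^ 2| ≤ β * x ^ 2 := by
  have h3 : ∀ x ∈ Icc 0 R, |-k * sn x + k * x| ≤ β * x ^ 1 := fun x hx =>
    abs_le_pow_succ_of_abs_deriv_le (g := fun x => -k * sn x + k * x)
      (g' := fun x => -(k * (cn x - 1))) 0 hβ (by simp [h.sn_zero])
      (fun x => (((h.hasDerivAt_sn x).const_mul (-k)).fun_add
        ((hasDerivAt_id' x).const_mul k)).congr_deriv (by ring))
      (fun x hx => by simpa using hR x hx) hx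
  have h2 : ∀ x ∈ Icc 0 R, |cn x - 1 + k / 2 * x ^ 2| ≤ β * x ^ 2 := fun x hx =>
    abs_le_pow_succ_of_abs_deriv_le (g := fun x => cn x - 1 + k / 2 * x ^ 2)
      (g' := fun x => -k * sn x + k * x) 1 hβ (by simp [h.cn_zero])
      (fun x => (((h.hasDerivAt_cn x).sub_const 1).fun_add
        (((hasDerivAt_id' x).fun_pow 2).const_mul (k / 2))).congr_deriv (by norm_num; ring)) h3 hx
  refine ⟨abs_le_pow_succ_of_abs_deriv_le (g := fun x => sn x - x + k / 6 * x ^ 3)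
      (g' := fun x => cn x - 1 + k / 2 * x ^ 2) 2 hβ (by simp [h.sn_zero])
      (fun x => (((h.hasDerivAt_sn x).fun_sub (hasDerivAt_id' x)).fun_add
        (((hasDerivAt_id' x).fun_pow 3).const_mul (k / 6))).congr_deriv (by norm_num; ring))
      h2 hx, h2 x hx⟩

/-- `sn(r) / r` as a function of `r²`. -/
noncomputable def modelSinc (sn : ℝ → ℝ) (q : ℝ) : ℝ := sn √q / √q

/-- The derivative of `modelSinc`. -/
noncomputable def modelSincDeriv (sn cn : ℝ → ℝ) (q : ℝ) : ℝ := (cn √q - modelSinc sn q) / (2 * q)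

section

variable {k : ℝ} {sn cn : ℝ → ℝ}

theorem IsModelPair.contDiffAt_modelSinc (h : IsModelPair k sn cn) {q : ℝ} (hq : 0 < q) :
    ContDiffAt ℝ ∞ (modelSinc sn) q := by
  have h1 : ContDiffAt ℝ ∞ Real.sqrt q := Real.contDiffAt_sqrt hq.ne'
  exact (h.contDiff_sn.contDiffAt.comp q h1).div h1 (Real.sqrt_pos.2 hq).ne'

theorem IsModelPair.hasDerivAt_modelSinc (h : IsModelPair k sn cn) {q : ℝ} (hq : 0 < q) :
    HasDerivAt (modelSinc sn) (modelSincDeriv sn cn q) q := by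
  have h1 := Real.hasDerivAt_sqrt hq.ne'
  have h0 : 0 < √q := Real.sqrt_pos.2 hq
  refine (((h.hasDerivAt_sn √q).comp q h1).fun_div h1 h0.ne').congr_deriv ?_
  have hs : q = √q ^ 2 := (Real.sq_sqrt hq.le).symm
  rw [modelSincDeriv, modelSinc]
  simp only [Function.comp]
  generalize √q = r at *
  subst hs
  field_simp

/-- For $\sigma$ = `modelSinc sn`, the equation $\operatorname{sn}''=-k\operatorname{sn}$ becomes
$4q\sigma''+6\sigma'+k\sigma=0$. -/
theorem IsModelPair.hasDerivAt_modelSincDeriv (h : IsModelPair k sn cn) {q : ℝ} (hq : 0 < q) :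
    HasDerivAt (modelSincDeriv sn cn)
      (-(k * modelSinc sn q + 6 * modelSincDeriv sn cn q) / (4 * q)) q := by
  have h1 := Real.hasDerivAt_sqrt hq.ne'
  have h0 : 0 < √q := Real.sqrt_pos.2 hq
  refine ((((h.hasDerivAt_cn √q).comp q h1).fun_sub (h.hasDerivAt_modelSinc hq)).fun_div
    ((hasDerivAt_id' q).const_mul 2) (by positivity)).congr_deriv ?_
  have e : cn √q = 2 * q * modelSincDeriv sn cn q + modelSinc sn q := by
    rw [modelSincDeriv]; field_simp; ring
  have e2 : sn √q = modelSinc sn q * √q := by rw [modelSinc]; field_simp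
  simp only [Function.comp]
  rw [e, e2]
  field_simp
  ring

theorem IsModelPair.abs_modelSinc_sub_le {β R : ℝ} (h : IsModelPair k sn cn)
    (hβ : 0 ≤ β) (hR : ∀ x ∈ Icc 0 R, |k * (cn x - 1)| ≤ β) {q : ℝ} (hq : 0 < q)
    (hqR : √q ≤ R) :
    |modelSinc sn q - (1 - k / 6 * q)| ≤ β * q ∧ |modelSincDeriv sn cn q + k / 6| ≤ β := by
  have h0 : 0 < √q := Real.sqrt_pos.2 hq
  have hs : √q ^ 2 = q := Real.sq_sqrt hq.le
  obtain ⟨h1, h2⟩ := h.abs_sub_taylor_le hβ hR ⟨h0.le, hqR⟩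
  rw [hs] at h2
  have h3 : |modelSinc sn q - (1 - k / 6 * q)| ≤ β * q := by
    have e : modelSinc sn q - (1 - k / 6 * q) = (sn √q - √q + k / 6 * √q ^ 3) / √q := by
      rw [modelSinc]
      clear h2 hqR h1
      generalize √q = r at *
      subst hs
      field_simp
      ring
    rw [e, abs_div, abs_of_pos h0, div_le_iff₀ h0]
    refine h1.trans (le_of_eq ?_)
    rw [← hs]; simp; ring
  refine ⟨h3, ?_⟩
  have e : modelSincDeriv sn cn q + k / 6 =
      ((cn √q - 1 + k / 2 * q) - (modelSinc sn q - (1 - k / 6 * q))) / (2 * q) := by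
    rw [modelSincDeriv]; field_simp; ring
  rw [e, abs_div, abs_of_pos (by positivity : 0 < 2 * q), div_le_iff₀ (by positivity)]
  refine (abs_sub _ _).trans ?_
  linarith

end

/-! ### The logarithmic potential. -/

/-- The logarithmic cutoff, equal to `-Λ` at `0` and to `0` for `q ≥ e^{-X}`. -/
noncomputable def logCutoff (Λ X q : ℝ) : ℝ :=
  -Λ * Real.smoothTransition (-Real.log (q + Real.exp (-2 * X)) / X - 1)

section logCutoff

variable {Λ X q : ℝ}

theorem contDiffAt_logCutoff (hq : 0 ≤ q) : ContDiffAt ℝ ∞ (logCutoff Λ X) q := by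
  have h1 : 0 < q + Real.exp (-2 * X) := by positivity
  have h2 : ContDiffAt ℝ ∞ (fun q => -Real.log (q + Real.exp (-2 * X)) / X - 1) q :=
    (((contDiffAt_id.add contDiffAt_const).log h1.ne').neg.div_const X).sub contDiffAt_const
  exact contDiffAt_const.mul (Real.smoothTransition.contDiffAt.comp q h2)

theorem logCutoff_zero (hX : 0 < X) : logCutoff Λ X 0 = -Λ := by
  rw [logCutoff, zero_add, Real.log_exp, Real.smoothTransition.one_of_one_le, mul_one]
  rw [le_sub_iff_add_le, le_div_iff₀ hX]
  linarith

theorem neg_le_logCutoff (hΛ : 0 ≤ Λ) : -Λ ≤ logCutoff Λ X q := by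
  rw [logCutoff]
  nlinarith [Real.smoothTransition.le_one (-Real.log (q + Real.exp (-2 * X)) / X - 1)]

theorem logCutoff_arg_nonpos (hX : 0 < X) (h : Real.exp (-X) ≤ q + Real.exp (-2 * X)) :
    -Real.log (q + Real.exp (-2 * X)) / X - 1 ≤ 0 := by
  have := Real.log_le_log (Real.exp_pos _) h
  rw [Real.log_exp] at this
  rw [sub_nonpos, div_le_iff₀ hX]
  linarith

theorem logCutoff_eq_zero (hX : 0 < X) (h : Real.exp (-X) ≤ q + Real.exp (-2 * X)) :
    logCutoff Λ X q = 0 := by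
  rw [logCutoff, Real.smoothTransition.zero_of_nonpos (logCutoff_arg_nonpos hX h), mul_zero]

theorem deriv_logCutoff (hq : 0 ≤ q) : deriv (logCutoff Λ X) q = Λ *
    deriv Real.smoothTransition (-Real.log (q + Real.exp (-2 * X)) / X - 1) /
    (X * (q + Real.exp (-2 * X))) := by
  have h1 : 0 < q + Real.exp (-2 * X) := by positivity
  have h2 := ((((hasDerivAt_id' q).add_const (Real.exp (-2 * X))).log h1.ne').fun_neg.div_const
    X).sub_const 1
  have h3 : DifferentiableAt ℝ Real.smoothTransition
      (-Real.log (q + Real.exp (-2 * X)) / X - 1) :=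
    (Real.smoothTransition.contDiffAt (n := 1)).differentiableAt (by simp)
  have h4 := (h3.hasDerivAt.comp q h2).const_mul (-Λ)
  refine (HasDerivAt.deriv (f := logCutoff Λ X) h4).trans ?_
  field_simp

theorem deriv_logCutoff_eq_zero (hX : 0 < X) (hq : 0 ≤ q)
    (h : Real.exp (-X) ≤ q + Real.exp (-2 * X)) : deriv (logCutoff Λ X) q = 0 := by
  rw [deriv_logCutoff hq, deriv_smoothTransition_of_nonpos (logCutoff_arg_nonpos hX h)]
  simp

/-- The logarithm contributes $1/(q+s)$ and the scale contributes $1/X$; then $q\le q+s$. The factor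
$X^{-2}$ beats the logarithmic growth of the correction to $\varphi$. -/
theorem mul_deriv_logCutoff_sq_le {C : ℝ} (hX : 0 < X) (hq : 0 ≤ q)
    (hC : ∀ x, |deriv Real.smoothTransition x| ≤ C) :
    q * deriv (logCutoff Λ X) q ^ 2 ≤ (Λ * C / X) ^ 2 / (q + Real.exp (-2 * X)) := by
  have h1 : 0 < q + Real.exp (-2 * X) := by positivity
  have hqs : q ≤ q + Real.exp (-2 * X) := by linarith [Real.exp_pos (-2 * X)]
  rw [deriv_logCutoff hq]
  have hC' := hC (-Real.log (q + Real.exp (-2 * X)) / X - 1)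
  generalize deriv Real.smoothTransition (-Real.log (q + Real.exp (-2 * X)) / X - 1) = t at *
  generalize q + Real.exp (-2 * X) = y at *
  have ht : t ^ 2 ≤ C ^ 2 := sq_le_sq' (abs_le.1 hC').1 (abs_le.1 hC').2
  calc q * (Λ * t / (X * y)) ^ 2 ≤ y * (Λ * t / (X * y)) ^ 2 := by gcongr
    _ = Λ ^ 2 * t ^ 2 / X ^ 2 / y := by field_simp
    _ ≤ Λ ^ 2 * C ^ 2 / X ^ 2 / y := by gcongr
    _ = _ := by ring

end logCutoff

/-! ### The warping profile and its derivatives. -/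

/-- `φ(r²) = f(r) / r` for the warping function `f`: equal to `1 - k q / 6 - α log (1 + q / s)` near
the axis and to `modelSinc` near the boundary. -/
noncomputable def warpProfile (k α s r : ℝ) (sn : ℝ → ℝ) (q : ℝ) : ℝ :=
  modelSinc sn q - (1 - Real.smoothTransition (q / r ^ 2 - 1)) *
    (modelSinc sn q - (1 - k / 6 * q) + α * Real.log (1 + q / s))

section warpProfile

variable {k α s r q : ℝ} {sn cn : ℝ → ℝ}

theorem warpProfile_of_le (hr : 0 < r) (hq : q ≤ r ^ 2) :
    warpProfile k α s r sn q = 1 - k / 6 * q - α * Real.log (1 + q / s) := by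
  rw [warpProfile, Real.smoothTransition.zero_of_nonpos]
  · ring
  · rw [sub_nonpos, div_le_one (by positivity)]; exact hq

theorem warpProfile_of_ge (hr : 0 < r) (hq : 2 * r ^ 2 ≤ q) :
    warpProfile k α s r sn q = modelSinc sn q := by
  rw [warpProfile, Real.smoothTransition.one_of_one_le]
  · ring
  · rw [le_sub_iff_add_le, le_div_iff₀ (by positivity)]; linarith

/-- Near the axis the two copies of `modelSinc` cancel, so its default value $0$ at $q=0$ is
harmless and an elementary analytic function remains. This is why the quadratic Taylor polynomial
replaces the model there. -/
theorem analyticAt_warpProfile_zero (hr : 0 < r) : AnalyticAt ℝ (warpProfile k α s r sn) 0 := by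
  have h1 : AnalyticAt ℝ (fun q : ℝ => 1 - k / 6 * q - α * Real.log (1 + q / s)) 0 := by
    have : AnalyticAt ℝ (fun q : ℝ => 1 + q / s) 0 :=
      analyticAt_const.add (analyticAt_id.div_const)
    exact (analyticAt_const.sub (analyticAt_const.mul analyticAt_id)).sub
      (analyticAt_const.mul (this.log (by simp)))
  refine h1.congr ?_
  filter_upwards [gt_mem_nhds (show (0 : ℝ) < r ^ 2 by positivity)] with q hq
  exact (warpProfile_of_le hr hq.le).symm

theorem IsModelPair.contDiffAt_warpProfile (h : IsModelPair k sn cn) (hr : 0 < r) (hs : 0 < s)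
    (hq : 0 ≤ q) : ContDiffAt ℝ ∞ (warpProfile k α s r sn) q := by
  rcases hq.eq_or_lt with rfl | hq
  · exact (analyticAt_warpProfile_zero hr).contDiffAt
  · have h1 := h.contDiffAt_modelSinc hq
    have h2 : ContDiffAt ℝ ∞ (fun q => Real.log (1 + q / s)) q :=
      ContDiffAt.log (by fun_prop) (by positivity)
    have h3 : ContDiffAt ℝ ∞ (fun q => Real.smoothTransition (q / r ^ 2 - 1)) q :=
      Real.smoothTransition.contDiffAt.comp q (by fun_prop)
    exact h1.sub ((contDiffAt_const.sub h3).mul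
      ((h1.sub (by fun_prop)).add (contDiffAt_const.mul h2)))

theorem deriv_warpProfile_of_lt (hr : 0 < r) (hs : 0 < s) (h0 : 0 ≤ q) (hq : q < r ^ 2) :
    deriv (warpProfile k α s r sn) q = -k / 6 - α / (q + s) ∧
    deriv (deriv (warpProfile k α s r sn)) q = α / (q + s) ^ 2 := by
  have hd : ∀ y, 0 < y + s → HasDerivAt (fun q : ℝ => 1 - k / 6 * q - α * Real.log (1 + q / s))
      (-k / 6 - α / (y + s)) y := by
    intro y hy
    have h1 : 1 + y / s ≠ 0 := by
      have : 1 + y / s = (y + s) / s := by field_simp; ring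
      rw [this]; positivity
    have := ((((hasDerivAt_id' y).const_mul (k / 6)).const_sub 1).fun_sub
      ((((hasDerivAt_id' y).div_const s).const_add 1).log h1 |>.const_mul α))
    refine this.congr_deriv ?_
    have : 1 + y / s = (y + s) / s := by field_simp; ring
    rw [this]
    field_simp
  have hev : ∀ y, y < r ^ 2 → warpProfile k α s r sn =ᶠ[𝓝 y]
      fun q : ℝ => 1 - k / 6 * q - α * Real.log (1 + q / s) := by
    intro y hy
    filter_upwards [gt_mem_nhds hy] with z hz using warpProfile_of_le hr hz.le
  have hqs : 0 < q + s := by positivity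
  refine ⟨(hev q hq).deriv_eq.trans (hd q hqs).deriv, ?_⟩
  have hev2 : deriv (warpProfile k α s r sn) =ᶠ[𝓝 q] fun y => -k / 6 - α / (y + s) := by
    filter_upwards [gt_mem_nhds hq, lt_mem_nhds (show -s < q by linarith)] with y hy hy'
    exact (hev y hy).deriv_eq.trans (hd y (by linarith)).deriv
  have := ((hasDerivAt_const q α).fun_div ((hasDerivAt_id' q).add_const s) hqs.ne').const_sub
    (-k / 6)
  rw [hev2.deriv_eq, this.deriv]
  ring

/-- The second derivative is multiplied by $4q$, as it occurs in the curvature; this lets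
$4q\sigma''=-(k\sigma+6\sigma')$ be used without division. -/
theorem IsModelPair.deriv_warpProfile (h : IsModelPair k sn cn) (hs : 0 < s)
    (hq : 0 < q) {σ σ1 d d1 χ χ1 χ2 : ℝ}
    (hσ : σ = modelSinc sn q) (hσ1 : σ1 = modelSincDeriv sn cn q)
    (hd : d = σ - (1 - k / 6 * q) + α * Real.log (1 + q / s))
    (hd1 : d1 = σ1 + k / 6 + α / (q + s)) (hχ : χ = 1 - Real.smoothTransition (q / r ^ 2 - 1))
    (hχ1 : χ1 = -(deriv Real.smoothTransition (q / r ^ 2 - 1) / r ^ 2))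
    (hχ2 : χ2 = -(deriv (deriv Real.smoothTransition) (q / r ^ 2 - 1) / r ^ 2 / r ^ 2)) :
    deriv (warpProfile k α s r sn) q = σ1 - (χ1 * d + χ * d1) ∧
    4 * q * deriv (deriv (warpProfile k α s r sn)) q = -(k * σ + 6 * σ1) -
      4 * q * (χ2 * d + 2 * χ1 * d1) - χ * (-(k * σ + 6 * σ1) - 4 * q * α / (q + s) ^ 2) := by
  have kσ : ∀ y, 0 < y → HasDerivAt (modelSinc sn) (modelSincDeriv sn cn y) y :=
    fun y hy => h.hasDerivAt_modelSinc hy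
  have kσ1 := h.hasDerivAt_modelSincDeriv hq
  have kl : ∀ y, 0 < y → HasDerivAt (fun q => α * Real.log (1 + q / s)) (α / (y + s)) y := by
    intro y hy
    refine (((((hasDerivAt_id' y).div_const s).const_add 1).log (by positivity)).const_mul
      α).congr_deriv ?_
    field_simp
    ring
  have kl1 : HasDerivAt (fun y => α / (y + s)) (-α / (q + s) ^ 2) q := by
    refine ((hasDerivAt_const q α).fun_div ((hasDerivAt_id' q).add_const s)
      (by positivity)).congr_deriv ?_
    ring
  have hs0 : ContDiff ℝ ∞ Real.smoothTransition := Real.smoothTransition.contDiff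
  have hs1 := (contDiff_infty_iff_deriv.1 hs0).2
  have karg : ∀ y, HasDerivAt (fun q : ℝ => q / r ^ 2 - 1) (1 / r ^ 2) y :=
    fun y => ((hasDerivAt_id' y).div_const (r ^ 2)).sub_const 1
  have kχ : ∀ y, HasDerivAt (fun q => 1 - Real.smoothTransition (q / r ^ 2 - 1))
      (-(deriv Real.smoothTransition (y / r ^ 2 - 1) / r ^ 2)) y := fun y => by
    refine ((((hs0.differentiable (by simp)).differentiableAt.hasDerivAt).comp y
      (karg y)).const_sub 1).congr_deriv (by ring)
  have kχ1 : HasDerivAt (fun y => -(deriv Real.smoothTransition (y / r ^ 2 - 1) / r ^ 2))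
      (-(deriv (deriv Real.smoothTransition) (q / r ^ 2 - 1) / r ^ 2 / r ^ 2)) q := by
    refine (((((hs1.differentiable (by simp)).differentiableAt.hasDerivAt).comp q
      (karg q)).div_const (r ^ 2)).fun_neg).congr_deriv (by ring)
  have kd : ∀ y, 0 < y → HasDerivAt
      (fun q => modelSinc sn q - (1 - k / 6 * q) + α * Real.log (1 + q / s))
      (modelSincDeriv sn cn y + k / 6 + α / (y + s)) y := fun y hy => by
    refine (((kσ y hy).fun_sub (((hasDerivAt_id' y).const_mul (k / 6)).const_sub 1)).fun_add
      (kl y hy)).congr_deriv (by ring)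
  have kφ : ∀ y, 0 < y → deriv (warpProfile k α s r sn) y = _ := fun y hy =>
    HasDerivAt.deriv (f := warpProfile k α s r sn) ((kσ y hy).fun_sub ((kχ y).fun_mul (kd y hy)))
  have hev := (eventually_gt_nhds hq).mono kφ
  have k2 := kσ1.fun_sub ((kχ1.fun_mul (kd q hq)).fun_add
    ((kχ q).fun_mul ((kσ1.add_const (k / 6)).fun_add kl1)))
  replace k2 := (k2.congr_of_eventuallyEq hev).deriv
  subst hσ1 hσ
  rw [← hd1, ← hd, ← hχ1, ← hχ2, ← hχ] at k2
  refine ⟨?_, ?_⟩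
  · rw [kφ q hq, ← hd, ← hd1, ← hχ, ← hχ1]
  · rw [k2]
    field_simp
    ring

end warpProfile

/-! ### The curvature and convexity estimates. -/

theorem abs_mul_le_mul {a b A B : ℝ} (ha : |a| ≤ A) (hb : |b| ≤ B) : |a * b| ≤ A * B := by
  rw [abs_mul]
  exact mul_le_mul ha hb (abs_nonneg _) ((abs_nonneg _).trans ha)

/-- The logarithm gives $Q\ge k+2\alpha/(q+s)$. If $q+s\ge B$, the potential is off and $\varphi$ is
close to $1$. Otherwise $\alpha/(q+s)\ge4a^2/(q+s)+K$: the first term absorbs $4qu^2$, and $K$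
leaves at least $|k|E^{-1}$, which survives multiplication by the small factor $E$. -/
theorem scalar_bound_of_lt {k ε q s α μ Q φ E u a B K L η : ℝ} (hq : 0 ≤ q) (hs : 0 < s)
    (hα : α = 4 * a ^ 2 + K * B) (hB : 0 < B)
    (hK : K = |k| * (L + 1)) (hL : 0 ≤ L) (hε : 0 < ε)
    (hφ : φ = 1 - k / 6 * q - μ) (hφ0 : 1 / 2 ≤ φ) (hφ2 : φ ≤ 2)
    (hQ : Q = -(6 * (-k / 6 - α / (q + s)) + 4 * q * (α / (q + s) ^ 2)))
    (hE : 0 < E) (hEL : E⁻¹ ≤ L)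
    (hk : |k / 6 * q| + |μ| ≤ η) (hη : (2 * |k| + ε) * η ≤ ε / 4)
    (hfar : B ≤ q + s → E = 1 ∧ u = 0) (hu : q * u ^ 2 ≤ a ^ 2 / (q + s)) :
    k - ε ≤ E * (Q / φ - 4 * q * u ^ 2) := by
  have hqs : 0 < q + s := by positivity
  have hα0 : 0 ≤ α := by rw [hα, hK]; positivity
  have hQ' : k + 2 * (α / (q + s)) ≤ Q := by
    have : q * (α / (q + s) ^ 2) ≤ α / (q + s) := by
      rw [← mul_div_assoc, div_le_div_iff₀ (by positivity) hqs]
      nlinarith [mul_nonneg hα0 (mul_nonneg hs.le hqs.le)]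
    rw [hQ]
    linarith
  have hφp : 0 < φ := by linarith
  by_cases hfar' : B ≤ q + s
  · obtain ⟨rfl, rfl⟩ := hfar hfar'
    rw [one_mul, zero_pow two_ne_zero, mul_zero, sub_zero, le_div_iff₀ hφp]
    have h1 : 0 ≤ α / (q + s) := by positivity
    have h2 : |(k - ε) * (-(k / 6 * q) - μ)| ≤ (|k| + ε) * η := by
      refine abs_mul_le_mul ?_ ?_
      · exact (abs_sub _ _).trans (by rw [abs_of_pos hε])
      · refine (abs_sub _ _).trans ?_
        rw [abs_neg]; exact hk
    have h3 : (k - ε) * φ = (k - ε) + (k - ε) * (-(k / 6 * q) - μ) := by rw [hφ]; ring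
    have hη0 : 0 ≤ η := le_trans (by positivity) hk
    nlinarith [le_abs_self ((k - ε) * (-(k / 6 * q) - μ)), mul_nonneg (abs_nonneg k) hη0]
  · rw [not_le] at hfar'
    have hK0 : 0 ≤ K := by rw [hK]; positivity
    -- Here $q+s<B$, so $KB/(q+s)\ge K$.
    have h1 : 4 * (a ^ 2 / (q + s)) + K ≤ α / (q + s) := by
      rw [hα, add_div, mul_div_assoc]
      have : K ≤ K * B / (q + s) := by
        rw [le_div_iff₀ hqs]
        gcongr
      linarith
    have h2 : φ * (4 * q * u ^ 2 + |k| * L) ≤ 2 * (4 * (a ^ 2 / (q + s)) + |k| * L) := by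
      have h5 : 0 ≤ 4 * q * u ^ 2 + |k| * L := by positivity
      calc φ * (4 * q * u ^ 2 + |k| * L) ≤ 2 * (4 * q * u ^ 2 + |k| * L) := by gcongr
        _ ≤ _ := by linarith
    have h4 : |k| * L + |k| = K := by rw [hK]; ring
    have h6 : φ * (4 * q * u ^ 2 + |k| * L) ≤ Q := by
      have := neg_abs_le k
      have := abs_nonneg k
      have : 0 ≤ |k| * L := by positivity
      linarith
    have h7 : 4 * q * u ^ 2 + |k| * L ≤ Q / φ := by
      rw [le_div_iff₀ hφp, mul_comm]; exact h6
    have h8 : |k| * E⁻¹ ≤ Q / φ - 4 * q * u ^ 2 := by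
      have : |k| * E⁻¹ ≤ |k| * L := by gcongr
      linarith
    have h9 : E * (|k| * E⁻¹) = |k| := by field_simp
    have := mul_le_mul_of_nonneg_left h8 hE.le
    rw [h9] at this
    linarith [le_abs_self k]

-- The profile differs from the model by $x_0d$ with $d=O(\kappa r^2)$ and $d'=O(\kappa)$. Each
-- derivative of the cutoff costs $r^{-2}$, and $q$ is comparable to $r^2$, so every error is
-- $O(\kappa)$ uniformly in $r$.
set_option maxHeartbeats 1000000 in
theorem scalar_bound_of_ge {k ε r q s α σ σ1 c d d1 x0 x1 x2 φ φ1 φ2 C κ η μ : ℝ} (hr : 0 < r)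
    (hq : r ^ 2 ≤ q) (hq4 : q ≤ 4 * r ^ 2) (hs : 0 < s) (hα : 0 ≤ α) (hε : 0 < ε)
    (hσ : |σ - (1 - k / 6 * q)| ≤ κ * q) (hσ1 : |σ1 + k / 6| ≤ κ) (hc : 1 / 2 ≤ c)
    (hcσ : σ + 2 * q * σ1 = c) (hμ0 : 0 ≤ μ) (hμ : μ ≤ κ * r ^ 2)
    (hd : d = σ - (1 - k / 6 * q) + μ) (hd1 : d1 = σ1 + k / 6 + α / (q + s))
    (hα' : α ≤ κ * r ^ 2) (h0 : 0 ≤ x0) (h0' : x0 ≤ 1) (h1 : |x1| ≤ C) (h2 : |x2| ≤ C)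
    (hφ : φ = σ - x0 * d) (hφ1 : φ1 = σ1 - (-(x1 / r ^ 2) * d + x0 * d1))
    (hφ2 : 4 * q * φ2 = -(k * σ + 6 * σ1) - 4 * q * (-(x2 / r ^ 2 / r ^ 2) * d +
      2 * -(x1 / r ^ 2) * d1) - x0 * (-(k * σ + 6 * σ1) - 4 * q * α / (q + s) ^ 2))
    (hη : (2 * |k| + ε) * η ≤ ε / 4) (hη1 : η ≤ 1 / 16) (hκ : 174 * C * κ ≤ ε / 2)
    (hκ2 : (21 + 40 * C) * κ ≤ 1 / 4) (hr1 : r ≤ 1)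
    (hkr : |k| * (4 * r ^ 2) ≤ η) (hκr : 8 * κ * r ^ 2 ≤ η) :
    (1 / 2 ≤ φ ∧ φ ≤ 2) ∧ 0 < φ + 2 * q * φ1 ∧ k - ε ≤ -(6 * φ1 + 4 * q * φ2) / φ := by
  have hr2 : 0 < r ^ 2 := by positivity
  have hq0 : 0 < q := hr2.trans_le hq
  have hκ0 : 0 ≤ κ := (abs_nonneg _).trans hσ1
  obtain ⟨y, hy⟩ : ∃ y, q = r ^ 2 * y := ⟨q / r ^ 2, by field_simp⟩
  have hy1 : 1 ≤ y := by
    refine le_of_mul_le_mul_left ?_ hr2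
    linarith
  have hy4 : |y| ≤ 4 := by
    rw [abs_of_pos (by linarith)]
    refine le_of_mul_le_mul_left ?_ hr2
    linarith
  -- Rescaling $q=r^2y$ and $d=r^2e$ cancels the powers of $r$ from the cutoff derivatives.
  obtain ⟨e, he⟩ : ∃ e, d = r ^ 2 * e := ⟨d / r ^ 2, by field_simp⟩
  have hd' : |d| ≤ 5 * κ * r ^ 2 := by
    rw [hd]
    refine (abs_add_le _ _).trans ?_
    rw [abs_of_nonneg hμ0]
    linarith [mul_le_mul_of_nonneg_left hq4 hκ0]
  have he' : |e| ≤ 5 * κ := by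
    rw [he, abs_mul, abs_of_pos hr2] at hd'
    refine le_of_mul_le_mul_left ?_ hr2
    linarith
  have hαq : α / (q + s) ≤ κ := by
    rw [div_le_iff₀ (by positivity)]
    have : κ * r ^ 2 ≤ κ * (q + s) := mul_le_mul_of_nonneg_left (by linarith) hκ0
    linarith
  have hαq0 : 0 ≤ α / (q + s) := by positivity
  have hd1' : |d1| ≤ 2 * κ := by
    rw [hd1]
    refine (abs_add_le _ _).trans ?_
    rw [abs_of_nonneg hαq0]
    linarith
  have hx0 : |x0| ≤ 1 := abs_le.2 ⟨by linarith, h0'⟩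
  have hkq : |k * q| ≤ η := by
    rw [abs_mul, abs_of_pos hq0]
    exact (mul_le_mul_of_nonneg_left hq4 (abs_nonneg k)).trans hkr
  have hσ' : |σ - 1| ≤ η := by
    have e1 : σ - 1 = (σ - (1 - k / 6 * q)) - k * q / 6 := by ring
    rw [e1]
    refine (abs_sub _ _).trans ?_
    rw [abs_div, abs_of_pos (show (0 : ℝ) < 6 by norm_num)]
    have := mul_le_mul_of_nonneg_left hq4 hκ0
    linarith
  have hη0 : 0 ≤ η := (abs_nonneg _).trans hkq
  have hxd : |x0 * d| ≤ 5 * κ * r ^ 2 := by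
    simpa using abs_mul_le_mul hx0 hd'
  have hφb : |φ - 1| ≤ 2 * η := by
    have e1 : φ - 1 = (σ - 1) - x0 * d := by rw [hφ]; ring
    rw [e1]
    refine (abs_sub _ _).trans ?_
    linarith
  obtain ⟨hφl, hφu⟩ := abs_le.1 hφb
  have g1 : x1 / r ^ 2 * d = x1 * e := by rw [he]; field_simp
  have g2 : 4 * q * (x2 / r ^ 2 / r ^ 2 * d) = 4 * (y * (x2 * e)) := by rw [he, hy]; field_simp
  have g3 : 4 * q * (2 * (x1 / r ^ 2) * d1) = 8 * (y * (x1 * d1)) := by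
    rw [hy]; field_simp; ring
  have hφ1' : 1 / 2 ≤ φ := by linarith only [hφl, hη1]
  refine ⟨⟨hφ1', by linarith only [hφu, hη1]⟩, ?_, ?_⟩
  · have e1 : φ + 2 * q * φ1 = c - x0 * d - 2 * r ^ 2 * (x0 * (y * d1)) +
        2 * r ^ 2 * (y * (x1 * e)) := by
      linear_combination hφ + 2 * q * hφ1 + hcσ + 2 * q * g1 + (2 * x1 * e - 2 * x0 * d1) * hy
    have b1 := abs_mul_le_mul hx0 (abs_mul_le_mul hy4 hd1')
    have b2 := abs_mul_le_mul hy4 (abs_mul_le_mul h1 he')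
    have hr21 : r ^ 2 ≤ 1 := pow_le_one₀ hr.le hr1
    have b3 : |r ^ 2 * (x0 * (y * d1))| ≤ 1 * (1 * (4 * (2 * κ))) :=
      abs_mul_le_mul (by rw [abs_of_pos hr2]; exact hr21) b1
    have b4 : |r ^ 2 * (y * (x1 * e))| ≤ 1 * (4 * (C * (5 * κ))) :=
      abs_mul_le_mul (by rw [abs_of_pos hr2]; exact hr21) b2
    have b5 : 5 * κ * r ^ 2 ≤ 5 * κ := mul_le_of_le_one_right (by positivity) hr21
    rw [e1]
    -- The errors add up to $(5+16+40C)\kappa\le\tfrac14$, less than $\tfrac12\le c$.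
    linarith only [(abs_le.1 b3).2, (abs_le.1 b4).1, (abs_le.1 hxd).2, b5, hc, hκ2]
  · rw [le_div_iff₀ (by linarith only [hφ1'])]
    have hpos : 0 ≤ 6 * (α / (q + s)) - 4 * q * α / (q + s) ^ 2 := by
      have : q * α / (q + s) ^ 2 ≤ α / (q + s) := by
        rw [div_le_div_iff₀ (by positivity) (by positivity)]
        have : 0 < q + s := by positivity
        have e : α * (q + s) ^ 2 - q * α * (q + s) = α * (s * (q + s)) := by ring
        linarith only [e, mul_nonneg hα (mul_nonneg hs.le this.le)]
      have e2 : 4 * q * α / (q + s) ^ 2 = 4 * (q * α / (q + s) ^ 2) := by ring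
      rw [e2]
      linarith
    -- The equation for $\sigma$ leaves $k$ as main term and a nonnegative logarithmic term. The
    -- cutoff errors are at most $(30+64+80)C\kappa=174C\kappa$.
    have e1 : -(6 * φ1 + 4 * q * φ2) = k + k * ((1 - x0) * (σ - 1)) +
        x0 * (6 * (α / (q + s)) - 4 * q * α / (q + s) ^ 2) -
        (6 * (x1 * e) + 8 * (y * (x1 * d1)) + 4 * (y * (x2 * e))) := by
      linear_combination -6 * hφ1 - hφ2 - 6 * g1 - g2 - g3 + 6 * x0 * hd1
    have b1 := abs_mul_le_mul h1 he'
    have b2 := abs_mul_le_mul hy4 (abs_mul_le_mul h1 hd1')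
    have b3 := abs_mul_le_mul hy4 (abs_mul_le_mul h2 he')
    have b4 := abs_mul_le_mul (le_refl |k|) (abs_mul_le_mul
      (show |1 - x0| ≤ 1 from abs_le.2 ⟨by linarith, by linarith⟩) hσ')
    have b5 : |(k - ε) * (φ - 1)| ≤ (|k| + ε) * (2 * η) :=
      abs_mul_le_mul ((abs_sub _ _).trans (by rw [abs_of_pos hε])) hφb
    have b6 := mul_nonneg h0 hpos
    have e3 : (k - ε) * φ = k - ε + (k - ε) * (φ - 1) := by ring
    rw [e1, e3]
    linarith only [b6, hη, hκ, (abs_le.1 b1).2, (abs_le.1 b2).2, (abs_le.1 b3).2, (abs_le.1 b4).1,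
      (abs_le.1 b5).2, mul_nonneg (abs_nonneg k) hη0, mul_nonneg hε.le hη0]

/-- Below $q=r^2$ the profile is explicit; above it the potential has already vanished, because
$e^{-X}\le r^2$. -/
theorem warpProfile_bounds {k ε C κ η r Λ X α : ℝ} {sn cn : ℝ → ℝ} (h : IsModelPair k sn cn)
    (hC : ∀ x, |deriv Real.smoothTransition x| ≤ C ∧ |deriv (deriv Real.smoothTransition) x| ≤ C)
    (hε : 0 < ε) (hr : 0 < r) (hr1 : r ≤ 1)
    (hη : (2 * |k| + ε) * η ≤ ε / 4) (hη1 : η ≤ 1 / 16) (hκ0 : 0 ≤ κ) (hκ : 174 * C * κ ≤ ε / 2)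
    (hκ2 : (21 + 40 * C) * κ ≤ 1 / 4)
    (hkr : |k| * (4 * r ^ 2) ≤ η) (hκr : 8 * κ * r ^ 2 ≤ η)
    (hcn : ∀ x ∈ Icc 0 (2 * r), |k * (cn x - 1)| ≤ κ) (hcn2 : ∀ x ∈ Icc 0 (2 * r), 1 / 2 ≤ cn x)
    (hX : 0 < X) (hΛ : 0 ≤ Λ) (hXr : Real.exp (-X) ≤ r ^ 2)
    (hα : α = 4 * (Λ * C / X) ^ 2 + |k| * (Real.exp (2 * Λ) + 1) * Real.exp (-X))
    (hα2 : α ≤ κ * r ^ 2)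
    (hμ : ∀ q, 0 ≤ q → q ≤ 4 * r ^ 2 → α * Real.log (1 + q / Real.exp (-2 * X)) ≤ κ * r ^ 2)
    {q : ℝ} (hq : 0 ≤ q) (hq4 : q ≤ 4 * r ^ 2) {φ : ℝ → ℝ}
    (hφ : φ = warpProfile k α (Real.exp (-2 * X)) r sn) :
    (1 / 2 ≤ φ q ∧ φ q ≤ 2) ∧ 0 < φ q + 2 * q * deriv φ q ∧
      k - ε ≤ Real.exp (2 * logCutoff Λ X q) * (-(6 * deriv φ q + 4 * q * deriv (deriv φ) q) / φ q
        - 4 * q * deriv (logCutoff Λ X) q ^ 2) := by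
  have hs := Real.exp_pos (-2 * X)
  have hα0 : 0 ≤ α := by rw [hα]; positivity
  have hμq := hμ q hq hq4
  have hμ0 : 0 ≤ α * Real.log (1 + q / Real.exp (-2 * X)) := by
    refine mul_nonneg hα0 (Real.log_nonneg ?_)
    have : 0 ≤ q / Real.exp (-2 * X) := by positivity
    linarith
  have hfar : Real.exp (-X) ≤ q + Real.exp (-2 * X) →
      Real.exp (2 * logCutoff Λ X q) = 1 ∧ deriv (logCutoff Λ X) q = 0 := fun hf =>
    ⟨by rw [logCutoff_eq_zero hX hf]; simp, deriv_logCutoff_eq_zero hX hq hf⟩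
  rcases lt_or_ge q (r ^ 2) with hqr | hqr
  · obtain ⟨e1, e2⟩ := deriv_warpProfile_of_lt (k := k) (α := α) (sn := sn) hr hs hq hqr
    rw [← hφ] at e1 e2
    have e0 := warpProfile_of_le (k := k) (α := α) (s := Real.exp (-2 * X)) (sn := sn) hr hqr.le
    rw [← hφ] at e0
    have hL : (Real.exp (2 * logCutoff Λ X q))⁻¹ ≤ Real.exp (2 * Λ) := by
      rw [← Real.exp_neg, Real.exp_le_exp]
      linarith [neg_le_logCutoff (X := X) (q := q) hΛ]
    have hkq : |k / 6 * q| ≤ η / 6 := by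
      rw [abs_mul, abs_div, abs_of_pos (show (0 : ℝ) < 6 by norm_num), abs_of_nonneg hq]
      linarith [mul_le_mul_of_nonneg_left hq4 (abs_nonneg k)]
    have hb1 := abs_le.1 hkq
    have hu := mul_deriv_logCutoff_sq_le (Λ := Λ) hX hq fun x => (hC x).1
    have hαq : 0 ≤ q * (α / (q + Real.exp (-2 * X))) ∧ q * (α / (q + Real.exp (-2 * X))) ≤ α := by
      refine ⟨by positivity, ?_⟩
      rw [← mul_div_assoc, div_le_iff₀ (by positivity)]
      nlinarith
    generalize α * Real.log (1 + q / Real.exp (-2 * X)) = μ at *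
    have hφ0 : 1 / 2 ≤ φ q := by rw [e0]; linarith
    have hφ2 : φ q ≤ 2 := by rw [e0]; linarith
    refine ⟨⟨hφ0, hφ2⟩, ?_, ?_⟩
    · rw [e0, e1]
      linarith
    · refine scalar_bound_of_lt (η := η) (μ := μ) hq hs hα (Real.exp_pos _) rfl (Real.exp_pos _).le
        hε e0 hφ0 hφ2 (by rw [e1, e2]) (Real.exp_pos _) hL ?_ hη hfar hu
      rw [abs_of_nonneg hμ0]
      linarith
  · have hq0 : 0 < q := (pow_pos hr 2).trans_le hqr
    obtain ⟨hE, hu⟩ := hfar (by linarith)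
    obtain ⟨e1, e2⟩ := h.deriv_warpProfile (α := α) (r := r) hs hq0 rfl rfl rfl rfl rfl rfl rfl
    rw [← hφ] at e1 e2
    have hsq : √q ≤ 2 * r := by
      rw [← Real.sqrt_sq (show 0 ≤ 2 * r by positivity)]
      exact Real.sqrt_le_sqrt (by linarith)
    obtain ⟨b1, b2⟩ := h.abs_modelSinc_sub_le hκ0 hcn hq0 hsq
    have hc := hcn2 √q ⟨Real.sqrt_nonneg q, hsq⟩
    have hcσ : modelSinc sn q + 2 * q * modelSincDeriv sn cn q = cn √q := by
      rw [modelSincDeriv]; field_simp; ring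
    have := scalar_bound_of_ge hr hqr hq4 hs hα0 hε b1 b2 hc hcσ hμ0 hμq rfl rfl hα2
      (by linarith [Real.smoothTransition.le_one (q / r ^ 2 - 1)])
      (by linarith [Real.smoothTransition.nonneg (q / r ^ 2 - 1)]) (hC _).1 (hC _).2
      (congrFun hφ q) e1 e2 hη hη1 hκ hκ2 hr1 hkr hκr
    rw [hE, hu]
    refine ⟨this.1, this.2.1, ?_⟩
    simpa using this.2.2

/-! ### The choice of the parameters. -/

/-- The logarithm is at most $4X$, and $4X\alpha=16(\Lambda C)^2/X+4KXe^{-X}\to0$. -/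
theorem exists_log_scale (k Λ C : ℝ) {a b : ℝ} (ha : 0 < a) (hb : 0 < b) :
    ∃ X α, 0 < X ∧ Real.exp (-X) ≤ b ∧
      α = 4 * (Λ * C / X) ^ 2 + |k| * (Real.exp (2 * Λ) + 1) * Real.exp (-X) ∧ α ≤ a ∧
      ∀ q, 0 ≤ q → q ≤ 4 → α * Real.log (1 + q / Real.exp (-2 * X)) ≤ a := by
  set K := |k| * (Real.exp (2 * Λ) + 1) with hK
  have h1 : Tendsto (fun X : ℝ => Real.exp (-X)) atTop (𝓝 0) := Real.tendsto_exp_neg_atTop_nhds_zero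
  have h2 : Tendsto (fun X : ℝ => 4 * X * (4 * (Λ * C / X) ^ 2 + K * Real.exp (-X))) atTop
      (𝓝 0) := by
    have h3 : Tendsto (fun X : ℝ => 16 * (Λ * C) ^ 2 * X⁻¹ + 4 * K * (X ^ 1 * Real.exp (-X))) atTop
        (𝓝 (16 * (Λ * C) ^ 2 * 0 + 4 * K * 0)) :=
      (tendsto_inv_atTop_zero.const_mul _).add
        ((Real.tendsto_pow_mul_exp_neg_atTop_nhds_zero 1).const_mul _)
    rw [mul_zero, mul_zero, add_zero] at h3
    refine h3.congr' ?_
    filter_upwards [eventually_gt_atTop 0] with X hX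
    field_simp
    ring
  obtain ⟨X, hX2, hX1, hXb, hXa⟩ := ((eventually_ge_atTop (1 : ℝ)).and
    ((eventually_ge_atTop (Real.log 5)).and ((h1.eventually (gt_mem_nhds hb)).and
      (h2.eventually (gt_mem_nhds ha))))).exists
  have hX : 0 < X := by linarith
  have hα0 : 0 ≤ 4 * (Λ * C / X) ^ 2 + K * Real.exp (-X) := by positivity
  refine ⟨X, _, hX, hXb.le, rfl, ?_, ?_⟩
  -- As $X\ge1$, $\alpha\le4X\alpha\le a$.
  · nlinarith
  · intro q hq hq4
    have hs := Real.exp_pos (-2 * X)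
    have hlog : Real.log (1 + q / Real.exp (-2 * X)) ≤ 4 * X := by
      have e : 1 + q / Real.exp (-2 * X) = (q + Real.exp (-2 * X)) / Real.exp (-2 * X) := by
        field_simp; ring
      rw [e, Real.log_div (by positivity) hs.ne', Real.log_exp]
      have h5 : Real.log (q + Real.exp (-2 * X)) ≤ Real.log 5 := by
        apply Real.log_le_log (by positivity)
        have : Real.exp (-2 * X) ≤ 1 := Real.exp_le_one_iff.2 (by linarith)
        linarith
      linarith
    calc _ ≤ (4 * (Λ * C / X) ^ 2 + K * Real.exp (-X)) * (4 * X) := by gcongr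
      _ ≤ a := by linarith

theorem IsModelPair.eventually_small {k : ℝ} {sn cn : ℝ → ℝ} (h : IsModelPair k sn cn) {κ η r₀ : ℝ}
    (hκ : 0 < κ) (hη : 0 < η) (hr₀ : 0 < r₀) :
    ∃ r, 0 < r ∧ r ≤ 1 ∧ 4 * r ≤ r₀ ∧ |k| * (4 * r ^ 2) ≤ η ∧ 8 * κ * r ^ 2 ≤ η ∧
      ∀ x ∈ Icc 0 (2 * r), |k * (cn x - 1)| ≤ κ ∧ 1 / 2 ≤ cn x := by
  have hcont := h.contDiff_cn.continuous
  have h1 : ∀ᶠ x in 𝓝 (0 : ℝ), |k * (cn x - 1)| < κ ∧ 1 / 2 < cn x := by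
    refine Eventually.and ?_ ?_
    · have : ContinuousAt (fun x => |k * (cn x - 1)|) 0 := by fun_prop
      exact this.eventually (gt_mem_nhds (by simpa [h.cn_zero] using hκ))
    · exact hcont.continuousAt.eventually (lt_mem_nhds (by rw [h.cn_zero]; norm_num))
  obtain ⟨d, hd, hball⟩ := Metric.eventually_nhds_iff.1 h1
  have h2 : ∀ᶠ r in 𝓝[>] (0 : ℝ), r < 1 ∧ 4 * r < r₀ ∧ |k| * (4 * r ^ 2) < η ∧
      8 * κ * r ^ 2 < η ∧ 2 * r < d := by
    apply eventually_nhdsWithin_of_eventually_nhds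
    refine Eventually.and ?_ (Eventually.and ?_ (Eventually.and ?_ (Eventually.and ?_ ?_)))
    · exact gt_mem_nhds zero_lt_one
    · exact (show ContinuousAt (fun r : ℝ => 4 * r) 0 by fun_prop).eventually
        (gt_mem_nhds (by simpa using hr₀))
    · exact (show ContinuousAt (fun r : ℝ => |k| * (4 * r ^ 2)) 0 by fun_prop).eventually
        (gt_mem_nhds (by simpa using hη))
    · exact (show ContinuousAt (fun r : ℝ => 8 * κ * r ^ 2) 0 by fun_prop).eventually
        (gt_mem_nhds (by simpa using hη))
    · exact (show ContinuousAt (fun r : ℝ => 2 * r) 0 by fun_prop).eventually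
        (gt_mem_nhds (by simpa using hd))
  obtain ⟨r, ⟨a1, a2, a3, a4, a5⟩, hr⟩ := (h2.and self_mem_nhdsWithin).exists
  refine ⟨r, hr, a1.le, a2.le, a3.le, a4.le, fun x hx => ?_⟩
  have := hball (y := x) (by
    rw [Real.dist_eq, sub_zero, abs_of_nonneg hx.1]; linarith [hx.2])
  exact ⟨this.1.le, this.2.le⟩

/-- The properties of the potential `U` and the profile `ψ` needed of a drawstring of radius `2 r`,
whose potential is supported in the cylinder of radius `b`. -/
theorem exists_drawstring_profile (k : ℝ) {ε δ r₀ : ℝ} (hε : 0 < ε) (hδ : 0 < δ) (hr₀ : 0 < r₀) :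
    ∃ (r b M : ℝ) (sn cn U ψ : ℝ → ℝ), IsModelPair k sn cn ∧
      (∀ s ∈ Icc 0 (2 * r), 0 < cn (s / 2)) ∧
      0 < r ∧ 4 * r ≤ r₀ ∧ |k| * r ^ 2 ≤ 1 / 10 ∧ 0 ≤ b ∧ b ≤ r ∧ 0 ≤ M ∧ M * b ≤ r ∧
      M * b ^ 2 ≤ r ^ 2 ∧
      (∀ q, 0 ≤ q → ContDiffAt ℝ ∞ U q) ∧ (∀ q, 0 ≤ q → ContDiffAt ℝ ∞ ψ q) ∧
      (∀ q, b ^ 2 ≤ q → U q = 0) ∧ (∀ q, 0 ≤ q → Real.exp (-U q) ≤ M) ∧ Real.exp (U 0) < δ ∧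
      (∀ q, 2 * r ^ 2 ≤ q → 1 - q * ψ q = modelSinc sn q) ∧
      ∀ q, 0 ≤ q → q ≤ 4 * r ^ 2 → 0 < 1 - q * ψ q ∧ 1 - q * ψ q ≤ 2 ∧
        0 < (1 - q * ψ q) - 2 * q * (ψ q + q * deriv ψ q) ∧
        k - ε ≤ Real.exp (2 * U q) *
          ((6 * (ψ q + q * deriv ψ q) + 4 * q * (2 * deriv ψ q + q * deriv (deriv ψ) q)) /
            (1 - q * ψ q) - 4 * q * deriv U q ^ 2) := by
  obtain ⟨sn, cn, h⟩ := exists_isModelPair k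
  obtain ⟨C, hC1, hC⟩ := exists_bound_deriv_smoothTransition
  obtain ⟨η, hη0, hη1, hη⟩ : ∃ η : ℝ, 0 < η ∧ η ≤ 1 / 16 ∧ (2 * |k| + ε) * η ≤ ε / 4 := by
    have hp : 0 < 2 * |k| + ε := by positivity
    refine ⟨min (1 / 16) (ε / 4 / (2 * |k| + ε)), by positivity, min_le_left _ _, ?_⟩
    calc _ ≤ (2 * |k| + ε) * (ε / 4 / (2 * |k| + ε)) := by gcongr; exact min_le_right _ _
      _ = _ := by field_simp
  obtain ⟨κ, hκ0, hκ, hκ2⟩ : ∃ κ : ℝ, 0 < κ ∧ 174 * C * κ ≤ ε / 2 ∧ (21 + 40 * C) * κ ≤ 1 / 4 := by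
    have hp : 0 < C := by linarith
    refine ⟨min (ε / 2 / (174 * C)) (1 / 4 / (21 + 40 * C)), by positivity, ?_, ?_⟩
    · calc _ ≤ 174 * C * (ε / 2 / (174 * C)) := by gcongr; exact min_le_left _ _
        _ = _ := by field_simp
    · calc _ ≤ (21 + 40 * C) * (1 / 4 / (21 + 40 * C)) := by gcongr; exact min_le_right _ _
        _ = _ := by field_simp
  obtain ⟨r, hr, hr1, hrr₀, hkr, hκr, hcn⟩ := h.eventually_small hκ0 hη0 hr₀
  obtain ⟨Λ, hΛ, hΛδ⟩ : ∃ Λ : ℝ, 0 ≤ Λ ∧ Real.exp (-Λ) < δ :=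
    ((eventually_ge_atTop (0 : ℝ)).and
      (Real.tendsto_exp_neg_atTop_nhds_zero.eventually (gt_mem_nhds hδ))).exists
  have hM1 : 1 ≤ Real.exp Λ := Real.one_le_exp hΛ
  -- $X$ is chosen last. The bound on $e^{-X}$ makes the core radius $b=e^{-X/2}$ satisfy $e^\Lambda
  -- b\le r$, which controls distance and volume.
  obtain ⟨X, α, hX, hXb, hα, hαa, hlog⟩ := exists_log_scale k Λ C
    (a := κ * r ^ 2) (b := (r / Real.exp Λ) ^ 2) (by positivity) (by positivity)
  set φ := warpProfile k α (Real.exp (-2 * X)) r sn with hφ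
  have hr21 : r ^ 2 ≤ 1 := pow_le_one₀ hr.le hr1
  have hrM : r / Real.exp Λ ≤ r := div_le_self hr.le hM1
  obtain ⟨ψ, hψ, hφψ⟩ := exists_eq_one_sub_mul
    (fun q hq => h.contDiffAt_warpProfile (α := α) hr (Real.exp_pos (-2 * X)) hq)
    (analyticAt_warpProfile_zero hr)
    (by rw [warpProfile_of_le hr (by positivity)]; simp)
  have hb : √(Real.exp (-X)) ≤ r / Real.exp Λ := by
    rw [← Real.sqrt_sq (show 0 ≤ r / Real.exp Λ by positivity)]
    exact Real.sqrt_le_sqrt hXb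
  have hb2 : √(Real.exp (-X)) ^ 2 = Real.exp (-X) := Real.sq_sqrt (Real.exp_pos _).le
  have hMb : Real.exp Λ * √(Real.exp (-X)) ≤ r := by
    rwa [le_div_iff₀ (Real.exp_pos _), mul_comm] at hb
  refine ⟨r, √(Real.exp (-X)), Real.exp Λ, sn, cn, logCutoff Λ X, ψ, h, ?_, hr, hrr₀, ?_,
    Real.sqrt_nonneg _, hb.trans hrM, (Real.exp_pos _).le, hMb, ?_,
    fun q hq => contDiffAt_logCutoff hq, hψ, ?_, ?_, ?_, ?_, ?_⟩
  · intro s hs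
    have := (hcn (s / 2) ⟨by linarith [hs.1], by linarith [hs.1, hs.2]⟩).2
    linarith
  · linarith
  · calc Real.exp Λ * √(Real.exp (-X)) ^ 2 = (Real.exp Λ * √(Real.exp (-X))) * √(Real.exp (-X)) := by
          ring
      _ ≤ r * r := mul_le_mul hMb (hb.trans hrM) (Real.sqrt_nonneg _) hr.le
      _ = r ^ 2 := by ring
  · intro q hq
    rw [hb2] at hq
    exact logCutoff_eq_zero hX (by linarith [Real.exp_pos (-2 * X)])
  · intro q _
    rw [Real.exp_le_exp]
    linarith [neg_le_logCutoff (X := X) (q := q) hΛ]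
  · rwa [logCutoff_zero hX]
  · intro q hq
    rw [← hφψ, warpProfile_of_ge hr hq]
  · intro q hq hq4
    obtain ⟨d1, d2⟩ := deriv_one_sub_mul hψ hφψ hq
    obtain ⟨⟨h1, h2⟩, h3, h4⟩ := warpProfile_bounds h hC hε hr hr1 hη hη1 hκ0.le hκ hκ2 hkr hκr
      (fun x hx => (hcn x hx).1) (fun x hx => (hcn x hx).2) hX hΛ
      (hXb.trans (pow_le_pow_left₀ (by positivity) hrM 2)) hα hαa
      (fun q h1 h2 => hlog q h1 (by linarith)) hq hq4 rfl
    rw [d1, hφψ q] at h3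
    rw [d1, d2, hφψ q] at h4
    rw [hφψ q] at h1 h2
    refine ⟨by linarith, h2, by linarith, h4.trans (le_of_eq ?_)⟩
    ring

end Drawstring

/-! ### Assembly of the theorem. -/

theorem theorem3p1 (k : ℝ) :
    ∃ C : ℝ, ∀ ε δ r₀ : ℝ, 0 < ε → 0 < δ → 0 < r₀ →
      ∃ (ρ r₁ : ℝ) (u f : ℝ → ℝ) (g : (Fin 3 → ℝ) → Matrix (Fin 3) (Fin 3) ℝ),
        -- a smooth doubly warped product metric on the solid cylinder
        0 < ρ ∧
        ContDiffOn ℝ ∞ u (Icc 0 ρ) ∧ ContDiffOn ℝ ∞ f (Icc 0 ρ) ∧ (∀ r ∈ Ioc 0 ρ, 0 < f r) ∧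
        IsRiemannianMetricOn (solidCylinder ρ) g ∧
        HasDoublyWarpedForm ρ u f g ∧
        -- the scalar curvature bound
        (∀ p ∈ solidCylinder ρ, 2 * (k - ε) ≤ scalarCurvature (solidCylinder ρ) g p) ∧
        -- a neighborhood of the lateral boundary is isometric to an annular region of the model
        0 < r₁ ∧ r₁ ≤ r₀ ∧ k * (2 * r₁) ^ 2 < Real.pi ^ 2 ∧
        (∃ (N : Set (Fin 3 → ℝ)) (Φ : (Fin 3 → ℝ) → Fin 3 → ℝ),
          N ⊆ solidCylinder ρ ∧ (∀ p ∈ lateralBoundary ρ, N ∈ 𝓝[solidCylinder ρ] p) ∧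
          IsRiemannianIsometry N g (annularRegion k (3 / 2 * r₁) (2 * r₁) univ)
            (productMetric k) Φ ∧
          Φ '' lateralBoundary ρ = annularRegion k (2 * r₁) (2 * r₁) univ) ∧
        -- the behavior of `u` near the boundary and near the axis
        (∀ᶠ r in 𝓝[Icc 0 ρ] ρ, u r = 0) ∧
        (∀ᶠ r in 𝓝[Icc 0 ρ] 0, Real.exp (u r) ≤ δ) ∧
        -- strict mean convexity of the level cylinders
        (∀ p ∈ solidCylinder ρ, 0 < radius p → 0 < meanCurvature (solidCylinder ρ) g radius p) ∧
        -- the distance from the axis to the boundary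
        setDist (solidCylinder ρ) g axis (lateralBoundary ρ) < ENNReal.ofReal r₀ ∧
        -- the volume
        riemannianVolume g {p ∈ solidCylinder ρ | p 2 ∈ Icc 0 1} <
          100 * riemannianVolume (productMetric k) (annularRegion k 0 (2 * r₁) (Icc 0 1)) ∧
        riemannianVolume g {p ∈ solidCylinder ρ | p 2 ∈ Icc 0 1} ≤
          ENNReal.ofReal (C * r₁ ^ 2) := by
  -- With $\rho=2r$ and $Mb^2\le r^2$, the volume bound $8\rho^2+8Mb^2$ is at most $40r^2$.
  refine ⟨40, fun ε δ r₀ hε hδ hr₀ => ?_⟩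
  obtain ⟨r, b, M, sn, cn, U, ψ, h, hcn, hr, hrr₀, hkr, hb0, hbr, hM0, hMb, hMb2, hU, hψ, hUb, hUM,
    hU0, hφsn, hφ⟩ := exists_drawstring_profile k hε hδ hr₀
  have hρ : 0 < 2 * r := by linarith
  have hrad : ∀ p ∈ solidCylinder (2 * r), radiusSq p ≤ 4 * r ^ 2 := by
    intro p hp
    have : radius p ^ 2 ≤ (2 * r) ^ 2 := pow_le_pow_left₀ (radius_nonneg p) hp 2
    rw [radius_sq] at this
    linarith
  have hφ0 : ∀ p ∈ solidCylinder (2 * r), 1 - radiusSq p * ψ (radiusSq p) ≠ 0 := fun p hp =>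
    (hφ _ (radiusSq_nonneg p) (hrad p hp)).1.ne'
  have hud := uniqueDiffOn_solidCylinder hρ
  have hvol : riemannianVolume (warpedMetric U ψ) {p ∈ solidCylinder (2 * r) | p 2 ∈ Icc 0 1} ≤
      ENNReal.ofReal (40 * r ^ 2) := by
    refine (riemannianVolume_warpedMetric_le hρ.le hb0 hM0 hUM hUb fun q h1 h2 => ?_).trans
      (ENNReal.ofReal_le_ofReal (by linarith))
    obtain ⟨h3, h4, -⟩ := hφ q h1 (by linarith)
    rw [abs_of_pos h3]
    exact h4
  have hsq : ∀ x ∈ Icc 0 (2 * r), ContDiffAt ℝ ∞ (fun r : ℝ => U (r ^ 2)) x ∧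
      ContDiffAt ℝ ∞ (fun r : ℝ => ψ (r ^ 2)) x := fun x _ =>
    ⟨ContDiffAt.comp (f := fun r : ℝ => r ^ 2) x (hU _ (sq_nonneg x)) (contDiffAt_id.pow 2),
      ContDiffAt.comp (f := fun r : ℝ => r ^ 2) x (hψ _ (sq_nonneg x)) (contDiffAt_id.pow 2)⟩
  -- On $\tfrac32r\le x\le2r$ one has $x^2\ge\tfrac94r^2>2r^2$ and $x>b$, so the profile is the
  -- model's and the potential is zero.
  obtain ⟨hiso, hbd⟩ := h.isRiemannianIsometry (U := U) (ψ := ψ) (a := 3 / 2 * r) (b := 2 * r)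
    (by linarith) (by linarith) hcn
    (fun q hq => hUb q (le_trans (pow_le_pow_left₀ hb0 (by linarith) 2) hq))
    (fun x h1 h2 => by
      have hx : 0 < x := by linarith
      rw [hφsn _ (by nlinarith), modelSinc, Real.sqrt_sq hx.le]
      field_simp)
  refine ⟨2 * r, r, fun x => U (x ^ 2), fun x => x * (1 - x ^ 2 * ψ (x ^ 2)), warpedMetric U ψ, hρ,
    fun x hx => (hsq x hx).1.contDiffWithinAt, fun x hx => ?_, fun x hx => ?_,
    isRiemannianMetricOn_warpedMetric hU hψ hφ0, hasDoublyWarpedForm_warpedMetric _ U ψ,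
    fun p hp => ?_, hr, by linarith, ?_, ⟨_, _, fun p hp => hp.2, fun p hp => ?_, hiso, hbd⟩,
    ?_, ?_, fun p hp hp0 => ?_, ?_, hvol.trans_lt ?_, hvol⟩
  · have := (hsq x hx).2
    exact (contDiffAt_id.mul (contDiffAt_const.sub
      ((contDiffAt_id.pow 2).mul this))).contDiffWithinAt
  · exact mul_pos hx.1 (hφ _ (sq_nonneg x) (by nlinarith [hx.1, hx.2])).1
  · rw [scalarCurvature_warpedMetric hud hU hψ hφ0 hp rfl]
    linarith [(hφ _ (radiusSq_nonneg p) (hrad p hp)).2.2.2]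
  · have hpi := Real.pi_gt_three
    nlinarith [le_abs_self k, sq_nonneg r]
  · have hp : radius p = 2 * r := hp
    have : ∀ᶠ y in 𝓝[solidCylinder (2 * r)] p, 3 / 2 * r < radius y :=
      mem_nhdsWithin_of_mem_nhds
        (continuous_radius.continuousAt.eventually (lt_mem_nhds (by linarith)))
    filter_upwards [this, self_mem_nhdsWithin] with y h1 h2 using ⟨h1.le, h2⟩
  · have : ∀ᶠ y in 𝓝[Icc 0 (2 * r)] (2 * r), b < y :=
      mem_nhdsWithin_of_mem_nhds (lt_mem_nhds (by linarith))
    filter_upwards [this] with y hy using hUb _ (pow_le_pow_left₀ hb0 hy.le 2)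
  · have hc : ContinuousAt (fun r : ℝ => Real.exp (U (r ^ 2))) 0 :=
      Real.continuous_exp.continuousAt.comp (hsq 0 ⟨le_rfl, hρ.le⟩).1.continuousAt
    have : ∀ᶠ y in 𝓝 (0 : ℝ), Real.exp (U (y ^ 2)) < δ :=
      hc.eventually (gt_mem_nhds (by simpa using hU0))
    filter_upwards [mem_nhdsWithin_of_mem_nhds this] with y hy using hy.le
  · rw [meanCurvature_warpedMetric hud hU hψ hφ0 hp hp0 rfl]
    obtain ⟨h1, -, h2, -⟩ := hφ _ (radiusSq_nonneg p) (hrad p hp)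
    have : 0 < √(radiusSq p) := hp0
    positivity
  -- The distance is at most $\rho+Mb\le3r<4r\le r_0$.
  · refine (setDist_warpedMetric_le hρ hb0 hM0 hUM hUb).trans_lt ?_
    exact (ENNReal.ofReal_lt_ofReal_iff hr₀).2 (by linarith)
  -- The model volume is at least $2r^2$, and $40<100\cdot2$.
  · have h1 := mul_le_mul_right (le_riemannianVolume_annularRegion hr hkr) (100 : ℝ≥0∞)
    refine lt_of_lt_of_le ?_ h1
    rw [show (100 : ℝ≥0∞) = ENNReal.ofReal 100 by simp, ← ENNReal.ofReal_mul (by norm_num)]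
    exact (ENNReal.ofReal_lt_ofReal_iff (by positivity)).2 (by nlinarith [pow_pos hr 2])
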